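/- Let $\mathcal X$ be a unital C$^*$-algebra and let $\mathcal M$ be a $\sigma$-finite von Neumann algebra on a nonzero Hilbert space $\mathcal H$ (every family of mutually orthogonal nonzero projections of $\mathcal M$ is countable), with set $\mathcal M_*$ of normal linear functionals. Let $\mathrm{CP}(\mathcal X,\mathcal M)$ be the set of completely positive maps $\mathcal X\to\mathcal M$. For $T\in\mathrm{CP}(\mathcal X,\mathcal M)$ let $(\pi_T,\mathcal K_T,V_T)$ be its minimal Stinespring representation, $T(X)=V_T^*\pi_T(X)V_T$, and let $\pi_T(\mathcal X)^c\subseteq B(\mathcal K_T)$ be the $\sigma$-weak closure of the linear span of all $R\in\pi_T(\mathcal X)'$ such that $0\le R\le 1$ and $X\mapsto V_T^*R\,\pi_T(X)V_T$ belongs to $\mathrm{CP}(\mathcal X,\mathcal M)$. Two maps $T_1,T_2\in\mathrm{CP}(\mathcal X,\mathcal M)$ are *disjoint* if no state $\omega$ on $\mathcal X$ is both $\pi_{T_1}$-normal and $\pi_{T_2}$-normal, where $\omega$ is $\pi$-normal if $\omega=\rho\circ\pi$ for some normal state $\rho$ on $\pi(\mathcal X)''$. They are *orthogonal* if, with $T=T_1+T_2$,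 there is a projection $P\in\pi_T(\mathcal X)^c$ with $T_1(X)=V_T^*P\pi_T(X)V_T$ and $T_2(X)=V_T^*(1-P)\pi_T(X)V_T$ for all $X\in\mathcal X$. A *CP-measure space* $(S,\mathcal F,\mu)$ is a measurable space $(S,\mathcal F)$ with a map $\mu:\mathcal F\to\mathrm{CP}(\mathcal X,\mathcal M)$ such that $\rho(\mu(\bigcup_i\Delta_i)X)=\sum_i\rho(\mu(\Delta_i)X)$ for all sequences $(\Delta_i)$ of mutually disjoint sets in $\mathcal F$, all $\rho\in\mathcal M_*$ and all $X\in\mathcal X$. Its *barycenter* is $T=\mu(S)$. It is *orthogonal* if $\mu(\Delta)$ and $\mu(\Delta^c)$ are orthogonal for all $\Delta\in\mathcal F$. Let $\nu$ be a finite positive measure on $(S,\mathcal F)$ equivalent to $\Delta\mapsto\rho(\mu(\Delta)1)$ for some normal faithful state $\rho$ on $\mathcal M$. For $f\in L^\infty(\nu)$ let $\kappa_\mu(f)$ be the unique element of $\pi_T(\mathcal X)^c$ with $$\rho\bigl(V_T^*\kappa_\mu(f)\pi_T(X)V_T\bigr)=\int_S f(s)\,d\rho(\mu(s)X)\qquad(X\in\mathcal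 X,\ \rho\in\mathcal M_*).$$ The CP-measure space is *subcentral* if it is orthogonal and its associated von Neumann algebra $\mathfrak B=\{\kappa_\mu(f)\mid f\in L^\infty(\nu)\}$ is an abelian von Neumann algebra contained in $\pi_T(\mathcal X)''\cap\pi_T(\mathcal X)^c$. **Theorem.** Let $(S,\mathcal F,\mu)$ be a CP-measure space with barycenter $T$. Then the following are equivalent: 1. $\mu(\Delta)$ and $\mu(\Delta^c)$ are disjoint for all $\Delta\in\mathcal F$; 2. $(S,\mathcal F,\mu)$ is subcentral. -/

import Mathlib

open scoped CStarAlgebra ComplexOrder InnerProductSpace ENNReal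
open ContinuousLinearMap MeasureTheory

universe u v w

namespace CPMeasureTheory

section Stinespring

variable {X : Type u} [CStarAlgebra X] [PartialOrder X] [StarOrderedRing X]
  {H : Type v} [NormedAddCommGroup H] [InnerProductSpace ℂ H] [CompleteSpace H]

/-- A minimal Stinespring representation `(π, K, V)` of a completely positive map
`T : X → B(H)`: `T x = V* π(x) V` and `π(X) V H` spans a dense subspace of `K`.
(By minimality, `π` is automatically unital.) -/
structure MinimalStinespring (T : X →CP (H →L[ℂ] H)) where
  K : Type (max u v)
  [instNACG : NormedAddCommGroup K]
  [instIPS : InnerProductSpace ℂ K]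
  [instComplete : CompleteSpace K]
  π : X →⋆ₐ[ℂ] (K →L[ℂ] K)
  V : H →L[ℂ] K
  apply_eq : ∀ x, T x = adjoint V ∘L π x ∘L V
  minimal : (Submodule.span ℂ {k : K | ∃ x h, π x (V h) = k}).topologicalClosure = ⊤

attribute [instance] MinimalStinespring.instNACG MinimalStinespring.instIPS
  MinimalStinespring.instComplete

/-! The next lemmas show that a minimal Stinespring representation exists; they serve only to
make `stinespring` below a definition. -/

lemma exists_star_mul_self_of_nonneg {A : Type*} [NonUnitalCStarAlgebra A] [PartialOrder A]
    [StarOrderedRing A] {a : A} (ha : 0 ≤ a) : ∃ b, a = star b * b :=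
  CStarAlgebra.nonneg_iff_eq_star_mul_self.1 ha

lemma cp_re_sum_nonneg {n : Type*} [Fintype n] (T : X →CP (H →L[ℂ] H)) (C : CStarMatrix n n X)
    (hC : 0 ≤ C) (h : n → H) : 0 ≤ (∑ i, ∑ j, ⟪h i, T (C i j) (h j)⟫_ℂ).re := by
  obtain ⟨N, hN⟩ := exists_star_mul_self_of_nonneg (T.map_cstarMatrix_nonneg C hC)
  have hent : ∀ i j, T (C i j) = ∑ k, star (N k i) * N k j := by
    intro i j
    have := congrFun (congrFun hN i) j
    rw [CStarMatrix.mul_apply] at this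
    simpa [CStarMatrix.star_apply] using this
  have : (∑ i, ∑ j, ⟪h i, T (C i j) (h j)⟫_ℂ)
      = ∑ k, ⟪∑ i, N k i (h i), ∑ j, N k j (h j)⟫_ℂ := by
    simp only [hent, sum_apply, inner_sum, sum_inner, FunLike.coe_mul_eq_comp, Function.comp_apply,
      star_eq_adjoint, adjoint_inner_right]
    rw [Finset.sum_congr rfl fun i _ => Finset.sum_comm, Finset.sum_comm]
    exact Finset.sum_congr rfl fun k _ => Finset.sum_comm
  rw [this, Complex.re_sum]
  exact Finset.sum_nonneg fun k _ => inner_self_nonneg (𝕜 := ℂ)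

lemma cstarMatrix_conj_nonneg {n : Type*} [Fintype n] (c : X) (hc : 0 ≤ c) (a : n → X) :
    0 ≤ CStarMatrix.ofMatrix (Matrix.of fun i j : n => star (a i) * c * a j) := by
  classical
  obtain ⟨d, rfl⟩ := exists_star_mul_self_of_nonneg hc
  rcases isEmpty_or_nonempty n with hn | ⟨⟨k₀⟩⟩
  · exact le_of_eq (CStarMatrix.ext fun i => hn.elim i)
  let N : CStarMatrix n n X := CStarMatrix.ofMatrix
    (Matrix.of fun k j : n => if k = k₀ then d * a j else 0)
  convert star_mul_self_nonneg N using 1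
  ext i j
  rw [CStarMatrix.mul_apply]
  simp [N, CStarMatrix.star_apply, CStarMatrix.ofMatrix_apply, mul_assoc, apply_ite star, ite_mul]


lemma cp_re_sum_conj_nonneg {ι : Type*} (s : Finset ι) (T : X →CP (H →L[ℂ] H)) (c : X) (hc : 0 ≤ c)
    (a : ι → X) (h : ι → H) :
    0 ≤ (∑ i ∈ s, ∑ j ∈ s, ⟪h i, T (star (a i) * c * a j) (h j)⟫_ℂ).re := by
  have := cp_re_sum_nonneg T _ (cstarMatrix_conj_nonneg c hc fun i : s => a i) fun i : s => h i
  simp only [CStarMatrix.ofMatrix_apply, Matrix.of_apply] at this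
  rw [← Finset.sum_coe_sort s]
  simpa only [← Finset.sum_coe_sort s] using this

lemma exists_kolmogorov (T : X →CP (H →L[ℂ] H)) :
    ∃ (K : Type (max u v)) (_ : NormedAddCommGroup K) (_ : InnerProductSpace ℂ K)
      (_ : CompleteSpace K) (e : X → H →L[ℂ] K),
      (∀ x y h h', ⟪e x h, e y h'⟫_ℂ = ⟪h, T (star x * y) h'⟫_ℂ) ∧
      (Submodule.span ℂ {k : K | ∃ x h, e x h = k}).topologicalClosure = ⊤ := by
  let κ : Matrix X X (H →L[ℂ] H) := Matrix.of fun x y => T (star x * y)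
  have hpos : κ.PosSemidef := by
    have htfae := RKHS.posSemidef_tfae (𝕜 := ℂ) (K := κ)
    refine (htfae.out 0 2).2 (And.intro ?_ fun vv => ?_)
    · ext1 x y
      simp [κ, Matrix.conjTranspose_apply, ← map_star]
    · have := cp_re_sum_conj_nonneg vv.support T 1 zero_le_one (fun x => x) vv
      rw [← Complex.conj_re] at this
      rw [Finsupp.sum, Finset.sum_congr rfl fun i _ => by rw [Finsupp.sum]]
      rw [Finset.sum_comm]
      simpa [κ, map_sum] using this
  have hfact : Fact κ.PosSemidef := ⟨hpos⟩
  have hk : RKHS.kernel (RKHS.OfKernel κ) = κ := RKHS.OfKernel.kernel_ofKernel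
  have key : ∀ (K : Type (max u v)) [NormedAddCommGroup K] [InnerProductSpace ℂ K]
      [CompleteSpace K] [RKHS ℂ K X H] (_ : RKHS.kernel K = κ),
      (∀ x y h h', ⟪RKHS.kerFun K x h, RKHS.kerFun K y h'⟫_ℂ = ⟪h, T (star x * y) h'⟫_ℂ) ∧
      (Submodule.span ℂ {k : K | ∃ x h, RKHS.kerFun K x h = k}).topologicalClosure = ⊤ := by
    intro K _ _ _ _ hK
    refine ⟨fun x y h h' => ?_, RKHS.kerFun_dense K⟩
    rw [← ContinuousLinearMap.adjoint_inner_right, ← ContinuousLinearMap.comp_apply,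
      ← RKHS.kernel_apply, hK]
    rfl
  exact ⟨RKHS.OfKernel κ, inferInstance, inferInstance, inferInstance, RKHS.kerFun _, key _ hk⟩

theorem exists_minimalStinespring (T : X →CP (H →L[ℂ] H)) : Nonempty (MinimalStinespring T) := by
  obtain ⟨K, _, _, _, e, he, hdense⟩ := exists_kolmogorov T
  have hd : Dense (Submodule.span ℂ {k : K | ∃ x h, e x h = k} : Set K) :=
    (Submodule.dense_iff_topologicalClosure_eq_top).2 hdense
  have hext : ∀ A B : K →L[ℂ] K, (∀ x h, A (e x h) = B (e x h)) → A = B := by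
    intro A B hAB
    refine ContinuousLinearMap.ext_on hd ?_
    rintro _ ⟨x, h, rfl⟩
    exact hAB x h
  have heq : ∀ k k' : K, (∀ x h, ⟪e x h, k⟫_ℂ = ⟪e x h, k'⟫_ℂ) → k = k' := by
    intro k k' hk
    refine ext_inner_right ℂ fun l => ?_
    have : innerSL ℂ k = innerSL ℂ k' := by
      refine ContinuousLinearMap.ext_on hd ?_
      rintro _ ⟨x, h, rfl⟩
      simpa using congrArg (starRingEnd ℂ) (hk x h)
    simpa using congrArg (fun A => A l) this
  have he0 : ∀ h, e 0 h = 0 := fun h => heq _ _ fun x h' => by simp [he]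
  have headd : ∀ a b h, e (a + b) h = e a h + e b h := fun a b h =>
    heq _ _ fun x h' => by simp [he, mul_add]
  have hesmul : ∀ (c : ℂ) a h, e (c • a) h = c • e a h := fun c a h =>
    heq _ _ fun x h' => by simp [he]
  let E : (X × H →₀ ℂ) →ₗ[ℂ] K := Finsupp.linearCombination ℂ fun p => e p.1 p.2
  let L : X → (X × H →₀ ℂ) →ₗ[ℂ] K := fun a => Finsupp.linearCombination ℂ fun p => e (a * p.1) p.2
  have hE : DenseRange E := by
    have h1 : Set.range E
        = (Submodule.span ℂ {k : K | ∃ x h, e x h = k} : Set K) := by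
      rw [← LinearMap.coe_range, Finsupp.range_linearCombination]
      congr 2
      ext k
      simp
    rw [DenseRange, h1, Submodule.dense_iff_topologicalClosure_eq_top]
    exact hdense
  have hnorm : ∀ a f, ‖L a f‖ ^ 2 = (∑ p ∈ f.support, ∑ q ∈ f.support,
      ⟪f p • p.2, T (star p.1 * (star a * a) * q.1) (f q • q.2)⟫_ℂ).re := by
    intro a f
    rw [← inner_self_eq_norm_sq (𝕜 := ℂ)]
    have : L a f = ∑ p ∈ f.support, e (a * p.1) (f p • p.2) := by
      simp [L, Finsupp.linearCombination_apply, Finsupp.sum]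
    rw [this]
    simp only [sum_inner, inner_sum, he, star_mul, mul_assoc]
    rw [Finset.sum_comm]
    simp
  have hbound : ∀ a f, ‖L a f‖ ≤ ‖a‖ * ‖E f‖ := by
    intro a f
    have h1 : E = L 1 := by simp [E, L]
    refine le_of_sq_le_sq ?_ (by positivity)
    rw [mul_pow, h1, hnorm, hnorm]
    have hc : 0 ≤ algebraMap ℝ X (‖a‖ ^ 2) - star a * a :=
      sub_nonneg.2 CStarAlgebra.star_mul_le_algebraMap_norm_sq
    have := cp_re_sum_conj_nonneg f.support T _ hc (fun p => p.1) (fun p => f p • p.2)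
    have hrw : ∀ p q : X × H, T (star p.1 * (algebraMap ℝ X (‖a‖ ^ 2) - star a * a) * q.1)
        = (‖a‖ ^ 2 : ℂ) • T (star p.1 * q.1) - T (star p.1 * (star a * a) * q.1) := by
      intro p q
      rw [mul_sub, sub_mul, map_sub, ← map_smul]
      congr 2
      rw [Algebra.algebraMap_eq_smul_one, mul_smul_comm, smul_mul_assoc, mul_one,
        ← Complex.coe_smul]
      simp
    simp only [hrw, sub_apply, smul_apply, inner_sub_right, inner_smul_right,
      Finset.sum_sub_distrib, ← Finset.mul_sum, Complex.sub_re] at this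
    rw [← Complex.ofReal_pow, Complex.re_ofReal_mul] at this
    simpa using this
  let π₀ : X → K →L[ℂ] K := fun a => (L a).extendOfNorm E
  have hπ : ∀ a x h, π₀ a (e x h) = e (a * x) h := by
    intro a x h
    have := LinearMap.extendOfNorm_eq hE ⟨‖a‖, hbound a⟩ (Finsupp.single (x, h) 1)
    simpa [E, L] using this
  let π : X →⋆ₐ[ℂ] (K →L[ℂ] K) :=
    { toFun := π₀
      map_one' := hext _ _ fun x h => by simp [hπ]
      map_mul' := fun a b => hext _ _ fun x h => by simp [hπ, mul_assoc]
      map_zero' := hext _ _ fun x h => by simp [hπ, he0]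
      map_add' := fun a b => hext _ _ fun x h => by simp [hπ, add_mul, headd]
      commutes' := fun c => hext _ _ fun x h => by
        simp [hπ, Algebra.algebraMap_eq_smul_one, hesmul]
      map_star' := fun a => by
        refine hext _ _ fun x h => heq _ _ fun y h' => ?_
        simp [star_eq_adjoint, adjoint_inner_right, hπ, he, mul_assoc] }
  refine ⟨{ K := K, π := π, V := e 1, apply_eq := fun x => ?_, minimal := ?_ }⟩
  · ext h
    refine ext_inner_left ℂ fun h' => ?_
    have : π x (e 1 h) = e x h := (hπ x 1 h).trans (by rw [mul_one])
    simp [adjoint_inner_right, this, he]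
  · convert hdense using 4 with k
    have : ∀ x h, π x (e 1 h) = e x h := fun x h => (hπ x 1 h).trans (by rw [mul_one])
    simp [this]

/-- The minimal Stinespring representation of `T` (unique up to unitary equivalence). -/
noncomputable def stinespring (T : X →CP (H →L[ℂ] H)) : MinimalStinespring T :=
  Classical.choice (exists_minimalStinespring T)

end Stinespring

section NormalFunctionals

variable {H : Type v} [NormedAddCommGroup H] [InnerProductSpace ℂ H] [CompleteSpace H]

/-- A pair of square-summable sequences of vectors. It encodes the trace class operator
`σ = ∑ |y n⟩⟨x n|`; every trace class operator is of this form. -/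
structure TracePair (H : Type v) [NormedAddCommGroup H] [InnerProductSpace ℂ H] where
  x : ℕ → H
  y : ℕ → H
  summable_x : Summable fun n => ‖x n‖ ^ 2
  summable_y : Summable fun n => ‖y n‖ ^ 2

/-- `Tr[σ A] = ∑ ⟨x n, A (y n)⟩` for `σ = ∑ |y n⟩⟨x n|`. -/
noncomputable def TracePair.trace (σ : TracePair H) (A : H →L[ℂ] H) : ℂ :=
  ∑' n, ⟪σ.x n, A (σ.y n)⟫_ℂ

/-- The σ-weak topology on `B(H)`: the coarsest one that makes all `A ↦ Tr[σ A]` continuous. -/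
noncomputable abbrev sigmaWeakTopology (H : Type v) [NormedAddCommGroup H] [InnerProductSpace ℂ H] :
    TopologicalSpace (H →L[ℂ] H) :=
  TopologicalSpace.induced (fun (A : H →L[ℂ] H) (σ : TracePair H) => σ.trace A)
    Pi.topologicalSpace

/-- The closure in the σ-weak topology. -/
noncomputable def sigmaWeakClosure (s : Set (H →L[ℂ] H)) : Set (H →L[ℂ] H) :=
  @closure _ (sigmaWeakTopology H) s

/-- Normal linear functionals `ρ(A) = Tr[σ A]` on a von Neumann algebra `M`. -/
structure NormalFunctional (M : VonNeumannAlgebra H) extends M.toStarSubalgebra →ₗ[ℂ] ℂ where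
  exists_trace : ∃ σ : TracePair H, ∀ A : M.toStarSubalgebra,
    toLinearMap A = σ.trace (A : H →L[ℂ] H)

/-- `ρ` is a (normal) state. -/
def NormalFunctional.IsState {M : VonNeumannAlgebra H} (ρ : NormalFunctional M) : Prop :=
  (∀ A : M.toStarSubalgebra, 0 ≤ (A : H →L[ℂ] H) → 0 ≤ ρ.toLinearMap A) ∧ ρ.toLinearMap 1 = 1

/-- `ρ` is faithful. -/
def NormalFunctional.IsFaithful {M : VonNeumannAlgebra H} (ρ : NormalFunctional M) : Prop :=
  ∀ A : M.toStarSubalgebra, 0 ≤ (A : H →L[ℂ] H) → ρ.toLinearMap A = 0 → A = 0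

/-- `M` is σ-finite: every set of mutually orthogonal projections of `M` is countable. -/
def IsSigmaFinite (M : VonNeumannAlgebra H) : Prop :=
  ∀ F : Set (H →L[ℂ] H), (∀ P ∈ F, P ∈ M ∧ IsStarProjection P) →
    (∀ P ∈ F, ∀ Q ∈ F, P ≠ Q → P * Q = 0) → F.Countable

end NormalFunctionals

section Representations

variable {X : Type u} [CStarAlgebra X]
  {K : Type v} [NormedAddCommGroup K] [InnerProductSpace ℂ K] [CompleteSpace K]
  {L : Type w} [NormedAddCommGroup L] [InnerProductSpace ℂ L] [CompleteSpace L]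

/-- The von Neumann algebra `π(X)''` generated by a representation. -/
noncomputable def bicommutant (π : X →⋆ₐ[ℂ] (K →L[ℂ] K)) : VonNeumannAlgebra K where
  toStarSubalgebra := StarSubalgebra.centralizer ℂ
    (StarSubalgebra.centralizer ℂ (Set.range π) : Set (K →L[ℂ] K))
  centralizer_centralizer' := by
    change Set.centralizer (Set.centralizer (StarSubalgebra.centralizer ℂ
      (StarSubalgebra.centralizer ℂ (Set.range π) : Set (K →L[ℂ] K)) : Set (K →L[ℂ] K))) =
      (StarSubalgebra.centralizer ℂ
        (StarSubalgebra.centralizer ℂ (Set.range π) : Set (K →L[ℂ] K)) : Set (K →L[ℂ] K))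
    simp only [StarSubalgebra.coe_centralizer]
    simp

lemma coe_bicommutant (π : X →⋆ₐ[ℂ] (K →L[ℂ] K)) :
    (bicommutant π : Set (K →L[ℂ] K)) = Set.centralizer (Set.centralizer (Set.range π)) := by
  have h : star (Set.range π) = Set.range π := by
    ext A
    rw [Set.mem_star]
    constructor
    · rintro ⟨x, hx⟩
      exact ⟨star x, by rw [map_star, hx, star_star]⟩
    · rintro ⟨x, rfl⟩
      exact ⟨star x, map_star π x⟩
  change (StarSubalgebra.centralizer ℂ
    (StarSubalgebra.centralizer ℂ (Set.range π) : Set (K →L[ℂ] K)) : Set (K →L[ℂ] K)) = _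
  rw [StarSubalgebra.coe_centralizer_centralizer, h, Set.union_self]

lemma mem_bicommutant (π : X →⋆ₐ[ℂ] (K →L[ℂ] K)) (x : X) :
    π x ∈ (bicommutant π).toStarSubalgebra := by
  change π x ∈ (bicommutant π : Set (K →L[ℂ] K))
  rw [coe_bicommutant]
  exact Set.subset_centralizer_centralizer ⟨x, rfl⟩

/-- `ω` is a state on the C⋆-algebra `X`. -/
def IsState [PartialOrder X] (ω : X →ₗ[ℂ] ℂ) : Prop := (∀ x : X, 0 ≤ x → 0 ≤ ω x) ∧ ω 1 = 1

/-- `ω = ρ ∘ π` for some normal state `ρ` on `π(X)''`. -/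
def IsNormalFor (π : X →⋆ₐ[ℂ] (K →L[ℂ] K)) (ω : X →ₗ[ℂ] ℂ) : Prop :=
  ∃ ρ : NormalFunctional (bicommutant π), ρ.IsState ∧
    ∀ x, ω x = ρ.toLinearMap ⟨π x, mem_bicommutant π x⟩

/-- Two representations are disjoint: no `π₁`-normal state is `π₂`-normal and vice versa. -/
def DisjointReps [PartialOrder X] (π₁ : X →⋆ₐ[ℂ] (K →L[ℂ] K)) (π₂ : X →⋆ₐ[ℂ] (L →L[ℂ] L)) : Prop :=
  ∀ ω : X →ₗ[ℂ] ℂ, IsState ω →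
    (IsNormalFor π₁ ω → ¬ IsNormalFor π₂ ω) ∧ (IsNormalFor π₂ ω → ¬ IsNormalFor π₁ ω)

end Representations

section CPMaps

variable {X : Type u} [CStarAlgebra X] [PartialOrder X] [StarOrderedRing X]
  {H : Type v} [NormedAddCommGroup H] [InnerProductSpace ℂ H] [CompleteSpace H]

/-- `CP(X, M)`: the completely positive maps `X → B(H)` with values in the von Neumann algebra
`M` on `H`. (A matrix over `M` is positive in `Mₙ(M)` iff it is positive in `Mₙ(B(H))`.) -/
structure CPMap (X : Type u) [CStarAlgebra X] [PartialOrder X] [StarOrderedRing X]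
    (M : VonNeumannAlgebra H) extends X →CP (H →L[ℂ] H) where
  mem' : ∀ x, toLinearMap x ∈ M.toStarSubalgebra

variable {M : VonNeumannAlgebra H}

/-- The value `T x` as an element of `M`. -/
noncomputable def CPMap.val (T : CPMap X M) (x : X) : M.toStarSubalgebra := ⟨T.toLinearMap x, T.mem' x⟩

/-- The sum of two completely positive maps. -/
noncomputable instance : Add (CPMap X M) where
  add T₁ T₂ :=
    { toLinearMap := T₁.toLinearMap + T₂.toLinearMap
      map_cstarMatrix_nonneg' := fun k A hA => by
        have h := add_nonneg (T₁.map_cstarMatrix_nonneg' k A hA)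
          (T₂.map_cstarMatrix_nonneg' k A hA)
        exact h
      mem' := fun x => add_mem (T₁.mem' x) (T₂.mem' x) }

namespace CPMap

/-- The Hilbert space `K_T` of the minimal Stinespring representation `(π_T, K_T, V_T)`. -/
abbrev K (T : CPMap X M) : Type (max u v) := (stinespring T.toCompletelyPositiveMap).K

/-- The representation `π_T`. -/
noncomputable abbrev π (T : CPMap X M) : X →⋆ₐ[ℂ] (T.K →L[ℂ] T.K) :=
  (stinespring T.toCompletelyPositiveMap).π

/-- The operator `V_T`. -/
noncomputable abbrev V (T : CPMap X M) : H →L[ℂ] T.K :=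
  (stinespring T.toCompletelyPositiveMap).V

/-- The operator `V_T* R π_T(x) V_T`. -/
noncomputable def compress (T : CPMap X M) (R : T.K →L[ℂ] T.K) (x : X) : H →L[ℂ] H :=
  adjoint T.V ∘L R ∘L T.π x ∘L T.V

/-- The `M`-relative commutant `π_T(X)^c`: the σ-weak closure of the linear span of all
`R ∈ π_T(X)'` with `0 ≤ R ≤ 1` for which `x ↦ V_T* R π_T(x) V_T` belongs to `CP(X, M)`. -/
noncomputable def relCommutant (T : CPMap X M) : Set (T.K →L[ℂ] T.K) :=
  sigmaWeakClosure (Submodule.span ℂ {R : T.K →L[ℂ] T.K |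
    R ∈ Set.centralizer (Set.range T.π) ∧ 0 ≤ R ∧ R ≤ 1 ∧
      ∃ T' : CPMap X M, ∀ x, T'.toLinearMap x = T.compress R x} : Set (T.K →L[ℂ] T.K))

/-- Orthogonality `T₁ ⊥ T₂`: with `T = T₁ + T₂`, there is a projection `P ∈ π_T(X)^c` such that
`T₁ = V_T* P π_T(·) V_T` and `T₂ = V_T* (1 - P) π_T(·) V_T`. -/
def Orthogonal (T₁ T₂ : CPMap X M) : Prop :=
  ∃ P ∈ (T₁ + T₂).relCommutant, IsStarProjection P ∧
    ∀ x, T₁.toLinearMap x = (T₁ + T₂).compress P x ∧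
      T₂.toLinearMap x = (T₁ + T₂).compress (1 - P) x

/-- `T₁` and `T₂` are disjoint if their minimal Stinespring representations are. -/
def DisjointCP (T₁ T₂ : CPMap X M) : Prop := DisjointReps T₁.π T₂.π

end CPMap

end CPMaps

section CPMeasures

variable {X : Type u} [CStarAlgebra X] [PartialOrder X] [StarOrderedRing X]
  {H : Type v} [NormedAddCommGroup H] [InnerProductSpace ℂ H] [CompleteSpace H]
  {M : VonNeumannAlgebra H} {S : Type w} [MeasurableSpace S]

/-- A `CP(X, M)`-valued measure on the measurable space `S`; only its values on measurable sets
matter. -/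
structure CPMeasure (S : Type w) [MeasurableSpace S] (X : Type u) [CStarAlgebra X]
    [PartialOrder X] [StarOrderedRing X] (M : VonNeumannAlgebra H) where
  toFun : Set S → CPMap X M
  hasSum' : ∀ Δ : ℕ → Set S, (∀ i, MeasurableSet (Δ i)) →
    Pairwise (Function.onFun Disjoint Δ) → ∀ (ρ : NormalFunctional M) (x : X),
      HasSum (fun i => ρ.toLinearMap ((toFun (Δ i)).val x))
        (ρ.toLinearMap ((toFun (⋃ i, Δ i)).val x))

namespace CPMeasure

/-- The barycenter `T = μ(S)`. -/
noncomputable def barycenter (μ : CPMeasure S X M) : CPMap X M := μ.toFun Set.univ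

/-- `μ` is orthogonal: `μ(Δ) ⊥ μ(Δᶜ)` for all measurable `Δ`. -/
def IsOrthogonal (μ : CPMeasure S X M) : Prop :=
  ∀ Δ, MeasurableSet Δ → (μ.toFun Δ).Orthogonal (μ.toFun Δᶜ)

open Classical in
/-- The complex measure `Δ ↦ ρ(μ(Δ) x)`. -/
noncomputable def scalar (μ : CPMeasure S X M) (ρ : NormalFunctional M) (x : X) :
    ComplexMeasure S where
  measureOf' Δ := if MeasurableSet Δ then ρ.toLinearMap ((μ.toFun Δ).val x) else 0
  empty' := by
    have h := μ.hasSum' (fun _ => ∅) (fun _ => MeasurableSet.empty)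
      (fun _ _ _ => disjoint_bot_left) ρ x
    simpa using (summable_const_iff _).1 h.summable
  not_measurable' Δ hΔ := if_neg hΔ
  m_iUnion' Δ hΔ hd := by
    simpa [hΔ, MeasurableSet.iUnion hΔ] using μ.hasSum' Δ hΔ hd ρ x

/-- `ν` is a finite positive measure equivalent to `Δ ↦ ρ(μ(Δ) 1)` for some normal faithful state
`ρ` on `M`. -/
def IsReference (μ : CPMeasure S X M) (ν : Measure S) : Prop :=
  IsFiniteMeasure ν ∧ ∃ ρ : NormalFunctional M, ρ.IsState ∧ ρ.IsFaithful ∧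
    ∀ Δ, MeasurableSet Δ → (ν Δ = 0 ↔ ρ.toLinearMap ((μ.toFun Δ).val 1) = 0)

/-- `A = κ_μ(f)`: `A` is the element of `π_T(X)^c` with `V_T* A π_T(x) V_T = ∫ f(s) dμ(s, x)`,
i.e. `ρ(V_T* A π_T(x) V_T) = ∫ f(s) dρ(μ(s, x))` for all normal functionals `ρ` on `M`. -/
def IsKappa (μ : CPMeasure S X M) {ν : Measure S} (f : Lp ℂ ∞ ν)
    (A : μ.barycenter.K →L[ℂ] μ.barycenter.K) : Prop :=
  A ∈ μ.barycenter.relCommutant ∧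
    ∀ x, ∃ hx : μ.barycenter.compress A x ∈ M.toStarSubalgebra, ∀ ρ : NormalFunctional M,
      ρ.toLinearMap ⟨μ.barycenter.compress A x, hx⟩ =
        (μ.scalar ρ x).integral (fun s => f s) (ContinuousLinearMap.mul ℝ ℂ)

/-- The set `{κ_μ(f) | f ∈ L^∞(ν)}`. -/
def kappaRange (μ : CPMeasure S X M) (ν : Measure S) :
    Set (μ.barycenter.K →L[ℂ] μ.barycenter.K) :=
  {A | ∃ f : Lp ℂ ∞ ν, μ.IsKappa f A}

/-- `μ` is subcentral: it is orthogonal, and its corresponding von Neumann algebra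
`{κ_μ(f) | f ∈ L^∞(ν)}` is an abelian von Neumann algebra contained in
`π_T(X)'' ∩ π_T(X)^c`, where `T` is the barycenter. (`κ_μ` is a homomorphism only if `μ` is
orthogonal, so that a corresponding von Neumann algebra is only defined in this case.) -/
def IsSubcentral (μ : CPMeasure S X M) : Prop :=
  μ.IsOrthogonal ∧ ∃ ν : Measure S, μ.IsReference ν ∧
    ∃ 𝔅 : VonNeumannAlgebra μ.barycenter.K,
      (𝔅 : Set (μ.barycenter.K →L[ℂ] μ.barycenter.K)) = μ.kappaRange ν ∧
      (∀ A ∈ 𝔅, ∀ B ∈ 𝔅, A * B = B * A) ∧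
      (𝔅 : Set (μ.barycenter.K →L[ℂ] μ.barycenter.K)) ⊆
        (bicommutant μ.barycenter.π : Set (μ.barycenter.K →L[ℂ] μ.barycenter.K)) ∩
          μ.barycenter.relCommutant

end CPMeasure

end CPMeasures

end CPMeasureTheory

/-!
Let `T` be the barycenter of `μ`, with minimal Stinespring representation `(π, K, V)`. Both
conditions say that `μ` is implemented by projections in the centre of `π(X)''`.

*Two maps.* Let `T = T₁ + T₂`. By minimality there are intertwiners `J₁`, `J₂` from `π` to the
representations of `T₁` and `T₂` with `J₁* J₁ + J₂* J₂ = 1` and `J₁ V = V₁`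
(`MinimalStinespring.exists_intertwiners`). There is no nonzero intertwiner `J` between disjoint
representations, since `J k` and `|J| k` induce the same functional (`DisjointReps.eq_zero`). So if
`T₁` and `T₂` are disjoint, then `J₂ B J₁* = 0` for all `B ∈ π(X)'`; this says that `P = J₁* J₁` is
a projection that commutes with `π(X)'`, and `T₁ = V* P π V` (`exists_central_projection`).
Conversely, let `T₁ = V* P π V` and `T₂ = V* (1 - P) π V` with `P` a central projection. A state
that is normal for both representations would have two normal extensions to `π(X)''` with the
values `1` and `0` at `P`, but normal functionals that agree on `π(X)` agree on `π(X)''`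
(`trace_eq_of_mem_bicommutant`, a form of the double commutant theorem). Hence `T₁` and `T₂` are
disjoint (`disjointReps_of_central_projection`).

*Subcentral measures have disjoint values.* The projection that implements the orthogonality of
`μ(Δ)` and `μ(Δᶜ)` is `κ_μ(1_Δ)`, so it lies in `π(X)' ∩ π(X)''`
(`CPMeasure.IsSubcentral.disjointCP`).

*Measures with disjoint values are subcentral.* Let `P(Δ)` be the central projection with
`μ(Δ) = V* P(Δ) π V`. As elements of `π(X)'` are determined by their compressions, `P` is a
projection valued measure (`CPMeasure.IsCentralDecomposition.isProjectionMeasure`), and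
`κ_μ(f) = ∫ f dP`; this integral is obtained as a norm convergent series over binary digits
(`exists_represents`). It remains to see that these integrals exhaust the von Neumann algebra
`P(S)''`, which is abelian and contained in the centre of `π(X)''`. As `M` is σ-finite, there is a
square summable sequence of vectors of `H` that is separating for `M`
(`IsSigmaFinite.exists_square_summable_separating`); it yields a faithful normal state of `M`, hence
a reference measure `ν`, and its image under `V` is a sequence `k` that is separating for `P(S)''`.
For `A ∈ P(S)''` the complex measure `Δ ↦ ∑ ⟨k n, A P(Δ) k n⟩` is dominated by `‖A‖ ν`, so it has
a bounded density `f`, and `A = ∫ f dP` because `k` is separating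
(`IsProjectionMeasure.exists_represents_of_mem_algebra`).
-/

namespace CPMeasureTheory

/-! ### The double commutant theorem for normal functionals -/

section DoubleCommutant

lemma memlp_two_of_summable {ι K : Type*} [NormedAddCommGroup K] {k : ι → K}
    (hk : Summable fun i => ‖k i‖ ^ 2) : Memℓp k 2 := by
  refine memℓp_gen ?_
  simpa using hk

variable {K : Type*} [NormedAddCommGroup K] [InnerProductSpace ℂ K] {ι : Type*}

/-- The operator `A ⊗ 1` on `ℓ²(ι, K)`: it applies `A` in every coordinate. -/
noncomputable def amplification (ι : Type*) (A : K →L[ℂ] K) :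
    lp (fun _ : ι => K) 2 →L[ℂ] lp (fun _ : ι => K) 2 :=
  lp.mapCLM 2 (fun _ => A) (norm_nonneg A) fun _ => le_rfl

lemma amplification_apply (A : K →L[ℂ] K) (k : lp (fun _ : ι => K) 2) (i : ι) :
    amplification ι A k i = A (k i) := rfl

lemma amplification_single [DecidableEq ι] (A : K →L[ℂ] K) (i : ι) (k : K) :
    amplification ι A (lp.single 2 i k) = lp.single 2 i (A k) := by
  ext j
  rw [amplification_apply]
  rcases eq_or_ne j i with rfl | h
  · simp
  · simp [h]

/-- An operator on `ℓ²(ι, K)` that commutes with `B ⊗ 1` for all `B ∈ s` commutes with `A ⊗ 1`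
for all `A ∈ s''`, because its matrix entries lie in `s'`. -/
lemma comm_amplification_of_mem_bicommutant {s : Set (K →L[ℂ] K)}
    {Q : lp (fun _ : ι => K) 2 →L[ℂ] lp (fun _ : ι => K) 2}
    (hQ : ∀ B ∈ s, ∀ k, Q (amplification ι B k) = amplification ι B (Q k))
    {A : K →L[ℂ] K} (hA : A ∈ Set.centralizer (Set.centralizer s)) (k : lp (fun _ : ι => K) 2) :
    Q (amplification ι A k) = amplification ι A (Q k) := by
  classical
  let q : ι → ι → K →L[ℂ] K := fun i j =>
    lp.evalCLM ℂ (fun _ : ι => K) 2 i ∘L Q ∘L lp.singleContinuousLinearMap ℂ (fun _ : ι => K) 2 j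
  have hq_apply : ∀ i j k, q i j k = Q (lp.single 2 j k) i := fun i j k => rfl
  have hq : ∀ i j, q i j ∈ Set.centralizer s := by
    intro i j B hB
    ext k
    change B (q i j k) = q i j (B k)
    rw [hq_apply, hq_apply, ← amplification_single, hQ B hB, amplification_apply]
  have key : Q ∘L amplification ι A = amplification ι A ∘L Q := by
    refine lp.ext_continuousLinearMap (by simp) fun j => ?_
    ext k i
    change Q (amplification ι A (lp.single 2 j k)) i = amplification ι A (Q (lp.single 2 j k)) i
    rw [amplification_single, amplification_apply, ← hq_apply, ← hq_apply]
    exact DFunLike.congr_fun (hA _ (hq i j)) k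
  exact DFunLike.congr_fun key k

variable [CompleteSpace K]

/-- The orthogonal projection onto a subspace that reduces `A` commutes with `A`. -/
lemma starProjection_comm_of_reducing (U : Submodule ℂ K) [U.HasOrthogonalProjection]
    (A : K →L[ℂ] K) (h : ∀ u ∈ U, A u ∈ U) (h' : ∀ u ∈ U, adjoint A u ∈ U) (k : K) :
    U.starProjection (A k) = A (U.starProjection k) := by
  refine U.eq_starProjection_of_mem_of_inner_eq_zero (h _ (U.starProjection_apply_mem k))
    fun u hu => ?_
  rw [← map_sub, ← adjoint_inner_right]
  exact U.starProjection_inner_eq_zero k _ (h' u hu)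

lemma adjoint_amplification (A : K →L[ℂ] K) :
    adjoint (amplification ι A) = amplification ι (adjoint A) := by
  refine ((eq_adjoint_iff _ _).2 fun k l => ?_).symm
  rw [lp.inner_eq_tsum, lp.inner_eq_tsum]
  exact tsum_congr fun i => by simp only [amplification_apply, adjoint_inner_left]

/-- A form of von Neumann's double commutant theorem: a normal functional that vanishes on a
self-adjoint multiplicative set `s` of operators vanishes on `s''`. -/
theorem tsum_inner_eq_zero_of_mem_bicommutant {s : Set (K →L[ℂ] K)} (h1 : 1 ∈ s)
    (hmul : ∀ A ∈ s, ∀ B ∈ s, A * B ∈ s) (hadj : ∀ A ∈ s, adjoint A ∈ s) {x y : ι → K}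
    (hx : Summable fun i => ‖x i‖ ^ 2) (hy : Summable fun i => ‖y i‖ ^ 2)
    (h : ∀ B ∈ s, ∑' i, ⟪x i, B (y i)⟫_ℂ = 0) {A : K →L[ℂ] K}
    (hA : A ∈ Set.centralizer (Set.centralizer s)) : ∑' i, ⟪x i, A (y i)⟫_ℂ = 0 := by
  -- `X` is orthogonal to the closed cyclic subspace `U` of `Y` under `s ⊗ 1`, which contains
  -- `(A ⊗ 1) Y` because the projection onto `U` commutes with `A ⊗ 1`.
  let X : lp (fun _ : ι => K) 2 := ⟨x, memlp_two_of_summable hx⟩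
  let Y : lp (fun _ : ι => K) 2 := ⟨y, memlp_two_of_summable hy⟩
  let U₀ := Submodule.span ℂ {k | ∃ B ∈ s, amplification ι B Y = k}
  let U := U₀.topologicalClosure
  have : CompleteSpace U := (Submodule.isClosed_topologicalClosure _).completeSpace_coe
  have hinv : ∀ B ∈ s, ∀ u ∈ U, amplification ι B u ∈ U := by
    intro B hB u hu
    refine map_mem_closure (amplification ι B).continuous hu fun u hu => ?_
    induction hu using Submodule.span_induction with
    | mem u hu =>
      obtain ⟨C, hC, rfl⟩ := hu
      exact Submodule.subset_span ⟨B * C, hmul B hB C hC, rfl⟩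
    | zero => simp
    | add a b _ _ ha hb => simpa using add_mem ha hb
    | smul c a _ ha => simpa using Submodule.smul_mem U₀ c ha
  have hY : Y ∈ U := subset_closure (Submodule.subset_span ⟨1, h1, rfl⟩)
  have hAY : amplification ι A Y ∈ U := by
    have hcomm := comm_amplification_of_mem_bicommutant (Q := U.starProjection)
      (fun B hB => starProjection_comm_of_reducing U _ (hinv B hB)
        (by rw [adjoint_amplification]; exact hinv _ (hadj B hB))) hA Y
    rw [Submodule.starProjection_eq_self_iff.2 hY] at hcomm
    exact Submodule.starProjection_eq_self_iff.1 hcomm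
  have hX : ∀ u ∈ U, ⟪X, u⟫_ℂ = 0 := by
    intro u hu
    have hker : U ≤ LinearMap.ker (innerSL ℂ X : _ →ₗ[ℂ] ℂ) := by
      refine Submodule.topologicalClosure_minimal _ (Submodule.span_le.2 ?_)
        (innerSL ℂ X).isClosed_ker
      rintro _ ⟨B, hB, rfl⟩
      simp only [SetLike.mem_coe, LinearMap.mem_ker]
      exact (lp.inner_eq_tsum _ _).trans (h B hB)
    exact hker hu
  exact (lp.inner_eq_tsum _ _).symm.trans (hX _ hAY)

end DoubleCommutant

/-! ### Decompositions of a completely positive map and its Stinespring representation -/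

section Comparison

variable {X : Type u} [CStarAlgebra X] [PartialOrder X] [StarOrderedRing X]
  {H : Type v} [NormedAddCommGroup H] [InnerProductSpace ℂ H] [CompleteSpace H]

namespace MinimalStinespring

variable {T T₁ T₂ : X →CP (H →L[ℂ] H)}

lemma inner_generators (S : MinimalStinespring T) (x y : X) (h h' : H) :
    ⟪S.π x (S.V h), S.π y (S.V h')⟫_ℂ = ⟪h, T (star x * y) h'⟫_ℂ := by
  rw [S.apply_eq, map_mul, map_star, star_eq_adjoint]
  change _ = ⟪h, adjoint S.V (adjoint (S.π x) (S.π y (S.V h')))⟫_ℂ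
  rw [adjoint_inner_right, adjoint_inner_right]

/-- Finite combinations of the vectors `π(x) V h`. -/
noncomputable def combination (S : MinimalStinespring T) : (X × H →₀ ℂ) →ₗ[ℂ] S.K :=
  Finsupp.linearCombination ℂ fun p => S.π p.1 (S.V p.2)

lemma combination_single (S : MinimalStinespring T) (x : X) (h : H) :
    S.combination (Finsupp.single (x, h) 1) = S.π x (S.V h) := by
  simp [combination]

lemma denseRange_combination (S : MinimalStinespring T) : DenseRange S.combination := by
  have h1 : Set.range S.combination
      = (Submodule.span ℂ {k : S.K | ∃ x h, S.π x (S.V h) = k} : Set S.K) := by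
    rw [← LinearMap.coe_range, combination, Finsupp.range_linearCombination]
    congr 2
    ext k
    simp
  rw [DenseRange, h1, Submodule.dense_iff_topologicalClosure_eq_top]
  exact S.minimal

/-- Operators out of `K` are determined by their values on the vectors `π(x) V h`. -/
lemma operator_ext (S : MinimalStinespring T) {L : Type*} [NormedAddCommGroup L]
    [NormedSpace ℂ L] {A B : S.K →L[ℂ] L}
    (h : ∀ x h, A (S.π x (S.V h)) = B (S.π x (S.V h))) : A = B := by
  refine ContinuousLinearMap.ext_on
    (Submodule.dense_iff_topologicalClosure_eq_top.2 S.minimal) ?_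
  rintro _ ⟨x, l, rfl⟩
  exact h x l

lemma vector_ext (S : MinimalStinespring T) {k l : S.K}
    (h : ∀ x h, ⟪S.π x (S.V h), k⟫_ℂ = ⟪S.π x (S.V h), l⟫_ℂ) : k = l := by
  refine ext_inner_right ℂ fun m => ?_
  have : innerSL ℂ k = innerSL ℂ l := S.operator_ext fun x h' => by
    simpa using congrArg (starRingEnd ℂ) (h x h')
  simpa using congrArg (fun A => A m) this

/-- An operator `A` in the commutant of `π(X)` is determined by the map `x ↦ V* A π(x) V`. -/
lemma ext_of_mem_centralizer (S : MinimalStinespring T) {A B : S.K →L[ℂ] S.K}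
    (hA : A ∈ Set.centralizer (Set.range S.π)) (hB : B ∈ Set.centralizer (Set.range S.π))
    (h : ∀ x, adjoint S.V ∘L A ∘L S.π x ∘L S.V = adjoint S.V ∘L B ∘L S.π x ∘L S.V) : A = B := by
  have key : ∀ C ∈ Set.centralizer (Set.range S.π), ∀ x y h h',
      ⟪S.π x (S.V h), C (S.π y (S.V h'))⟫_ℂ
        = ⟪h, (adjoint S.V ∘L C ∘L S.π (star x * y) ∘L S.V) h'⟫_ℂ := by
    intro C hC x y h h'
    have h1 : C (S.π (star x * y) (S.V h')) = S.π (star x) (C (S.π y (S.V h'))) := by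
      rw [map_mul]
      exact (DFunLike.congr_fun (hC _ ⟨star x, rfl⟩) (S.π y (S.V h'))).symm
    change _ = ⟪h, adjoint S.V (C (S.π (star x * y) (S.V h')))⟫_ℂ
    rw [adjoint_inner_right, h1, map_star, star_eq_adjoint, adjoint_inner_right]
  refine S.operator_ext fun y h' => S.vector_ext fun x l => ?_
  rw [key A hA, key B hB, h]

lemma inner_combination (S : MinimalStinespring T) (f g : X × H →₀ ℂ) :
    ⟪S.combination f, S.combination g⟫_ℂ
      = ∑ p ∈ f.support, ∑ q ∈ g.support, ⟪f p • p.2, T (star p.1 * q.1) (g q • q.2)⟫_ℂ := by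
  simp only [combination, Finsupp.linearCombination_apply, Finsupp.sum, sum_inner, inner_sum]
  rw [Finset.sum_comm]
  simp only [inner_smul_left, inner_smul_right, inner_generators, map_smul]

/-- If `T = T₁ + T₂`, the representation of `T` is carried onto those of `T₁` and `T₂` by
intertwiners `J₁` and `J₂` with `J₁* J₁ + J₂* J₂ = 1`. In particular `T₁ = V* (J₁* J₁) π V`. -/
theorem exists_intertwiners (S : MinimalStinespring T) (S₁ : MinimalStinespring T₁)
    (S₂ : MinimalStinespring T₂) (hT : ∀ x, T x = T₁ x + T₂ x) :
    ∃ (J₁ : S.K →L[ℂ] S₁.K) (J₂ : S.K →L[ℂ] S₂.K),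
      (∀ x, J₁ ∘L S.π x = S₁.π x ∘L J₁) ∧ (∀ x, J₂ ∘L S.π x = S₂.π x ∘L J₂) ∧
      J₁ ∘L S.V = S₁.V ∧ J₂ ∘L S.V = S₂.V ∧ DenseRange J₁ ∧ DenseRange J₂ ∧
      adjoint J₁ ∘L J₁ + adjoint J₂ ∘L J₂ = 1 := by
  have hinner : ∀ f g, ⟪S.combination f, S.combination g⟫_ℂ
      = ⟪S₁.combination f, S₁.combination g⟫_ℂ + ⟪S₂.combination f, S₂.combination g⟫_ℂ := by
    intro f g
    simp only [inner_combination, hT, add_apply, inner_add_right, Finset.sum_add_distrib]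
  have hnorm : ∀ f, ‖S.combination f‖ ^ 2
      = ‖S₁.combination f‖ ^ 2 + ‖S₂.combination f‖ ^ 2 := by
    intro f
    have := congrArg Complex.re (hinner f f)
    rw [Complex.add_re] at this
    simpa only [← Complex.ofReal_pow, inner_self_eq_norm_sq_to_K, Complex.coe_algebraMap,
      Complex.ofReal_re] using this
  have hd := S.denseRange_combination
  have h₁ := LinearMap.extendOfNorm_eq (f := S₁.combination) hd
    ⟨1, fun f => le_of_sq_le_sq (by rw [one_mul, hnorm]; simp) (by positivity)⟩
  have h₂ := LinearMap.extendOfNorm_eq (f := S₂.combination) hd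
    ⟨1, fun f => le_of_sq_le_sq (by rw [one_mul, hnorm]; simp) (by positivity)⟩
  set J₁ := S₁.combination.extendOfNorm S.combination
  set J₂ := S₂.combination.extendOfNorm S.combination
  have g₁ : ∀ x h, J₁ (S.π x (S.V h)) = S₁.π x (S₁.V h) := fun x h => by
    rw [← combination_single, h₁, combination_single]
  have g₂ : ∀ x h, J₂ (S.π x (S.V h)) = S₂.π x (S₂.V h) := fun x h => by
    rw [← combination_single, h₂, combination_single]
  refine ⟨J₁, J₂, fun x => S.operator_ext fun y h => ?_, fun x => S.operator_ext fun y h => ?_,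
    ?_, ?_, ?_, ?_, ?_⟩
  · simp only [comp_apply, g₁]
    simpa [g₁] using g₁ (x * y) h
  · simp only [comp_apply, g₂]
    simpa [g₂] using g₂ (x * y) h
  · ext h
    simpa using g₁ 1 h
  · ext h
    simpa using g₂ 1 h
  · refine S₁.denseRange_combination.mono ?_
    rintro _ ⟨f, rfl⟩
    exact ⟨_, h₁ f⟩
  · refine S₂.denseRange_combination.mono ?_
    rintro _ ⟨f, rfl⟩
    exact ⟨_, h₂ f⟩
  · refine S.operator_ext fun y h' => S.vector_ext fun x h => ?_
    simp only [add_apply, comp_apply, inner_add_right, adjoint_inner_right]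
    change _ = ⟪_, S.π y (S.V h')⟫_ℂ
    rw [← combination_single, ← combination_single, h₁, h₁, h₂, h₂, hinner]

end MinimalStinespring

end Comparison

/-! ### Disjoint representations and intertwiners -/

section Intertwiners

variable {X : Type u} [CStarAlgebra X]
  {K : Type v} [NormedAddCommGroup K] [InnerProductSpace ℂ K]

/-- The trace pair of the rank one operator `|l⟩⟨k|`: its only nonzero entries are at index `0`. -/
noncomputable def TracePair.rankOne (k l : K) : TracePair K where
  x n := if n = 0 then k else 0
  y n := if n = 0 then l else 0
  summable_x := summable_of_ne_finset_zero (s := {0}) fun n hn => by simp_all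
  summable_y := summable_of_ne_finset_zero (s := {0}) fun n hn => by simp_all

lemma TracePair.trace_rankOne (k l : K) (A : K →L[ℂ] K) :
    (TracePair.rankOne k l).trace A = ⟪k, A l⟫_ℂ := by
  rw [TracePair.trace, tsum_eq_single 0]
  · simp [TracePair.rankOne]
  · intro n hn
    simp [TracePair.rankOne, hn]

lemma TracePair.norm_inner_le (σ : TracePair K) (A : K →L[ℂ] K) (n : ℕ) :
    ‖⟪σ.x n, A (σ.y n)⟫_ℂ‖ ≤ ‖A‖ * (‖σ.x n‖ ^ 2 + ‖σ.y n‖ ^ 2) := by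
  have h1 : ‖⟪σ.x n, A (σ.y n)⟫_ℂ‖ ≤ ‖σ.x n‖ * (‖A‖ * ‖σ.y n‖) :=
    (norm_inner_le_norm _ _).trans (by gcongr; exact A.le_opNorm _)
  nlinarith [mul_nonneg (norm_nonneg A) (sq_nonneg (‖σ.x n‖ - ‖σ.y n‖)),
    mul_nonneg (norm_nonneg A) (sq_nonneg (‖σ.x n‖)),
    mul_nonneg (norm_nonneg A) (sq_nonneg (‖σ.y n‖))]

lemma TracePair.summable_norm_sq (σ : TracePair K) :
    Summable fun n => ‖σ.x n‖ ^ 2 + ‖σ.y n‖ ^ 2 := σ.summable_x.add σ.summable_y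

lemma TracePair.summable_norm_inner (σ : TracePair K) (A : K →L[ℂ] K) :
    Summable fun n => ‖⟪σ.x n, A (σ.y n)⟫_ℂ‖ :=
  Summable.of_nonneg_of_le (fun _ => norm_nonneg _) (σ.norm_inner_le A)
    (σ.summable_norm_sq.mul_left _)

lemma TracePair.summable_inner (σ : TracePair K) (A : K →L[ℂ] K) :
    Summable fun n => ⟪σ.x n, A (σ.y n)⟫_ℂ := (σ.summable_norm_inner A).of_norm

/-- The functional `A ↦ Tr[σ A]` as a bounded functional on `B(K)`. -/
noncomputable def TracePair.traceCLM (σ : TracePair K) : (K →L[ℂ] K) →L[ℂ] ℂ :=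
  LinearMap.mkContinuous
    { toFun := σ.trace
      map_add' := fun A B => by
        simp only [TracePair.trace, add_apply, inner_add_right]
        exact (σ.summable_inner A).tsum_add (σ.summable_inner B)
      map_smul' := fun c A => by
        simp only [TracePair.trace, smul_apply, inner_smul_right, tsum_mul_left, RingHom.id_apply,
          smul_eq_mul] }
    (∑' n, (‖σ.x n‖ ^ 2 + ‖σ.y n‖ ^ 2)) fun A => by
      refine (norm_tsum_le_tsum_norm (σ.summable_norm_inner A)).trans ?_
      rw [mul_comm, ← tsum_mul_left]
      exact (σ.summable_norm_inner A).tsum_le_tsum (σ.norm_inner_le A)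
        (σ.summable_norm_sq.mul_left _)

lemma TracePair.traceCLM_apply (σ : TracePair K) (A : K →L[ℂ] K) : σ.traceCLM A = σ.trace A := rfl

lemma summable_norm_sq_map {L : Type*} [NormedAddCommGroup L] [InnerProductSpace ℂ L]
    {ι : Type*} (J : K →L[ℂ] L) {k : ι → K} (hk : Summable fun n => ‖k n‖ ^ 2) :
    Summable fun n => ‖J (k n)‖ ^ 2 := by
  refine Summable.of_nonneg_of_le (fun _ => sq_nonneg _) (fun n => ?_) (hk.mul_left (‖J‖ ^ 2))
  rw [← mul_pow]
  gcongr
  exact J.le_opNorm _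

lemma inner_apply_nonneg {A : K →L[ℂ] K} (hA : 0 ≤ A) (k : K) : 0 ≤ ⟪k, A k⟫_ℂ :=
  (nonneg_iff_isPositive A |>.1 hA).inner_nonneg_right k

variable [CompleteSpace K]
  {L : Type w} [NormedAddCommGroup L] [InnerProductSpace ℂ L] [CompleteSpace L]

/-- Two normal functionals that agree on a self-adjoint multiplicative set `s` agree on `s''`. -/
theorem trace_eq_of_mem_bicommutant {s : Set (K →L[ℂ] K)} (h1 : 1 ∈ s)
    (hmul : ∀ A ∈ s, ∀ B ∈ s, A * B ∈ s) (hadj : ∀ A ∈ s, adjoint A ∈ s) {σ τ : TracePair K}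
    (h : ∀ B ∈ s, σ.trace B = τ.trace B) {A : K →L[ℂ] K}
    (hA : A ∈ Set.centralizer (Set.centralizer s)) : σ.trace A = τ.trace A := by
  -- The difference of the two functionals is given by vectors indexed by `ℕ ⊕ ℕ`.
  let x : ℕ ⊕ ℕ → K := Sum.elim σ.x fun n => -τ.x n
  let y : ℕ ⊕ ℕ → K := Sum.elim σ.y τ.y
  have hneg : Summable fun n => ‖-τ.x n‖ ^ 2 := by simpa only [norm_neg] using τ.summable_x
  have hx : Summable fun i => ‖x i‖ ^ 2 :=
    Summable.sum (fun i => ‖x i‖ ^ 2) σ.summable_x hneg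
  have hy : Summable fun i => ‖y i‖ ^ 2 :=
    Summable.sum (fun i => ‖y i‖ ^ 2) σ.summable_y τ.summable_y
  have key : ∀ B : K →L[ℂ] K, ∑' i, ⟪x i, B (y i)⟫_ℂ = σ.trace B - τ.trace B := by
    intro B
    have hl : HasSum (fun n => ⟪-τ.x n, B (τ.y n)⟫_ℂ) (-τ.trace B) := by
      simp only [inner_neg_left]
      exact (τ.summable_inner B).hasSum.neg
    rw [sub_eq_add_neg]
    exact HasSum.tsum_eq (HasSum.sum (f := fun i => ⟪x i, B (y i)⟫_ℂ)
      (σ.summable_inner B).hasSum hl)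
  rw [← sub_eq_zero, ← key]
  exact tsum_inner_eq_zero_of_mem_bicommutant h1 hmul hadj hx hy
    (fun B hB => by rw [key, h B hB, sub_self]) hA

/-- The normal functional `A ↦ Tr[σ A]` on `M`. -/
noncomputable def NormalFunctional.ofTracePair (M : VonNeumannAlgebra K) (σ : TracePair K) :
    NormalFunctional M where
  toLinearMap := σ.traceCLM.toLinearMap ∘ₗ M.toStarSubalgebra.subtype.toLinearMap
  exists_trace := ⟨σ, fun _ => rfl⟩

lemma NormalFunctional.ofTracePair_apply (M : VonNeumannAlgebra K) (σ : TracePair K)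
    (A : M.toStarSubalgebra) :
    (NormalFunctional.ofTracePair M σ).toLinearMap A = σ.trace (A : K →L[ℂ] K) := rfl

/-- The normal functional `A ↦ ⟨k, A l⟩`. -/
noncomputable def NormalFunctional.vector (M : VonNeumannAlgebra K) (k l : K) :
    NormalFunctional M := NormalFunctional.ofTracePair M (TracePair.rankOne k l)

lemma NormalFunctional.vector_apply (M : VonNeumannAlgebra K) (k l : K) (A : M.toStarSubalgebra) :
    (NormalFunctional.vector M k l).toLinearMap A = ⟪k, (A : K →L[ℂ] K) l⟫_ℂ :=
  TracePair.trace_rankOne k l _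

/-- A vector state is normal for the representation. -/
lemma isNormalFor_vector (π : X →⋆ₐ[ℂ] (K →L[ℂ] K)) {ω : X →ₗ[ℂ] ℂ} {k : K} (hk : ‖k‖ = 1)
    (hω : ∀ x, ω x = ⟪k, π x k⟫_ℂ) : IsNormalFor π ω := by
  refine ⟨NormalFunctional.vector _ k k, ⟨fun A hA => ?_, ?_⟩, fun x => ?_⟩
  · rw [NormalFunctional.vector_apply]
    exact inner_apply_nonneg hA k
  · rw [NormalFunctional.vector_apply]
    simp [inner_self_eq_norm_sq_to_K, hk]
  · rw [hω, NormalFunctional.vector_apply]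

lemma adjoint_intertwines {π₁ : X →⋆ₐ[ℂ] (K →L[ℂ] K)} {π₂ : X →⋆ₐ[ℂ] (L →L[ℂ] L)}
    {J : K →L[ℂ] L} (hJ : ∀ x, J ∘L π₁ x = π₂ x ∘L J) (x : X) :
    adjoint J ∘L π₂ x = π₁ x ∘L adjoint J := by
  have := congrArg adjoint (hJ (star x))
  simp only [adjoint_comp, map_star, star_eq_adjoint, adjoint_adjoint] at this
  exact this.symm

/-- There is no nonzero intertwiner between disjoint representations: for an intertwiner `J`, the
vectors `J k` and `|J| k` induce the same functional. -/
theorem DisjointReps.eq_zero [PartialOrder X] [StarOrderedRing X] {π₁ : X →⋆ₐ[ℂ] (K →L[ℂ] K)}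
    {π₂ : X →⋆ₐ[ℂ] (L →L[ℂ] L)} (h : DisjointReps π₁ π₂) {J : K →L[ℂ] L}
    (hJ : ∀ x, J ∘L π₁ x = π₂ x ∘L J) : J = 0 := by
  by_contra hne
  obtain ⟨k₀, hk₀⟩ : ∃ k, J k ≠ 0 := by
    by_contra! hc
    exact hne (by ext k; simpa using hc k)
  obtain ⟨k, hk⟩ : ∃ k, ‖J k‖ = 1 :=
    ⟨((‖J k₀‖⁻¹ : ℝ) : ℂ) • k₀, by
      rw [map_smul, norm_smul, Complex.norm_real, norm_inv, norm_norm,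
        inv_mul_cancel₀ (norm_ne_zero_iff.2 hk₀)]⟩
  have hpos : 0 ≤ adjoint J ∘L J := by
    rw [nonneg_iff_isPositive]
    exact isPositive_adjoint_comp_self J
  have hcomm : ∀ x, Commute (adjoint J ∘L J) (π₁ x) := by
    intro x
    change (adjoint J ∘L J) ∘L π₁ x = π₁ x ∘L (adjoint J ∘L J)
    rw [comp_assoc, hJ, ← comp_assoc, adjoint_intertwines hJ, comp_assoc]
  -- `R = |J|` commutes with `π₁`, and `|J|² = J* J`.
  let R : K →L[ℂ] K := CFC.sqrt (adjoint J ∘L J)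
  have hR0 : 0 ≤ R := CFC.sqrt_nonneg _
  have hRR : R ∘L R = adjoint J ∘L J := CFC.sqrt_mul_sqrt_self _ hpos
  have hRadj : adjoint R = R := (IsSelfAdjoint.of_nonneg hR0).star_eq
  have hRcomm : ∀ x, R ∘L π₁ x = π₁ x ∘L R := by
    intro x
    have : Commute R (π₁ x) := by
      rw [show R = _ from CFC.sqrt_eq_cfc]
      exact (hcomm x).cfc_nnreal _
    exact this
  let ω : X →ₗ[ℂ] ℂ :=
    { toFun := fun x => ⟪J k, π₂ x (J k)⟫_ℂ
      map_add' := fun x y => by simp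
      map_smul' := fun c x => by simp }
  have hω : ∀ x, ω x = ⟪R k, π₁ x (R k)⟫_ℂ := by
    intro x
    change ⟪J k, (π₂ x ∘L J) k⟫_ℂ = ⟪R k, (π₁ x ∘L R) k⟫_ℂ
    rw [← hJ, ← hRcomm, comp_apply, comp_apply, ← adjoint_inner_right, ← adjoint_inner_right,
      hRadj]
    exact congrArg (fun A : K →L[ℂ] K => ⟪k, A (π₁ x k)⟫_ℂ) hRR.symm
  have hω1 : ω 1 = 1 := by
    change ⟪J k, π₂ 1 (J k)⟫_ℂ = 1
    simp [inner_self_eq_norm_sq_to_K, hk]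
  have hRk : ‖R k‖ = 1 := by
    have h1 := hω 1
    rw [hω1, map_one] at h1
    change 1 = ⟪R k, R k⟫_ℂ at h1
    rw [inner_self_eq_norm_sq_to_K] at h1
    have h2 : ‖R k‖ ^ 2 = 1 := by simpa using (congrArg norm h1).symm
    exact (pow_eq_one_iff_of_nonneg (norm_nonneg _) two_ne_zero).1 h2
  have hst : IsState ω := by
    refine ⟨fun x hx => ?_, hω1⟩
    exact inner_apply_nonneg (map_nonneg π₂ hx) (J k)
  exact (h ω hst).1 (isNormalFor_vector π₁ hRk hω) (isNormalFor_vector π₂ hk fun x => rfl)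

end Intertwiners

/-! ### Disjointness and central projections -/

section CentralProjection

lemma adjoint_mem_centralizer_range {X : Type u} [CStarAlgebra X]
    {K : Type v} [NormedAddCommGroup K] [InnerProductSpace ℂ K] [CompleteSpace K]
    {π : X →⋆ₐ[ℂ] (K →L[ℂ] K)} {B : K →L[ℂ] K} (hB : B ∈ Set.centralizer (Set.range π)) :
    adjoint B ∈ Set.centralizer (Set.range π) := by
  rintro _ ⟨x, rfl⟩
  have h := congrArg star (hB _ ⟨star x, rfl⟩)
  rw [star_mul, star_mul, map_star, star_star] at h
  exact h.symm

variable {X : Type u} [CStarAlgebra X] [PartialOrder X] [StarOrderedRing X]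
  {H : Type v} [NormedAddCommGroup H] [InnerProductSpace ℂ H] [CompleteSpace H]
  {T T₁ T₂ : X →CP (H →L[ℂ] H)}

/-- If `T = T₁ + T₂` with `T₁` and `T₂` disjoint, then `T₁ = V* P π V` for a central
projection `P` of the von Neumann algebra `π(X)''` generated by the representation of `T`. -/
theorem exists_central_projection (S : MinimalStinespring T) (S₁ : MinimalStinespring T₁)
    (S₂ : MinimalStinespring T₂) (hT : ∀ x, T x = T₁ x + T₂ x) (hd : DisjointReps S₁.π S₂.π) :
    ∃ P : S.K →L[ℂ] S.K, IsStarProjection P ∧ P ∈ Set.centralizer (Set.range S.π) ∧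
      P ∈ Set.centralizer (Set.centralizer (Set.range S.π)) ∧
      ∀ x, T₁ x = adjoint S.V ∘L P ∘L S.π x ∘L S.V := by
  obtain ⟨J₁, J₂, hJ₁, hJ₂, hV₁, hV₂, -, -, hsum⟩ := S.exists_intertwiners S₁ S₂ hT
  have hJ₁' := adjoint_intertwines hJ₁
  -- `J₂ B J₁*` intertwines the two disjoint representations.
  have key : ∀ B ∈ Set.centralizer (Set.range S.π), ∀ k, J₂ (B (adjoint J₁ k)) = 0 := by
    intro B hB k
    have hz : J₂ ∘L B ∘L adjoint J₁ = 0 := by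
      refine hd.eq_zero fun x => ?_
      have hBx : B ∘L S.π x = S.π x ∘L B := (hB _ ⟨x, rfl⟩).symm
      rw [comp_assoc, comp_assoc, hJ₁', ← comp_assoc B, hBx, comp_assoc, ← comp_assoc J₂, hJ₂,
        comp_assoc]
    exact DFunLike.congr_fun hz k
  set P : S.K →L[ℂ] S.K := adjoint J₁ ∘L J₁ with hP
  have hsub : 1 - P = adjoint J₂ ∘L J₂ := by rw [← hsum, add_sub_cancel_left]
  have hPadj : adjoint P = P := by rw [hP, adjoint_comp, adjoint_adjoint]
  -- Hence the range of `P` reduces the commutant; `B = 1` shows that `P` is idempotent.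
  have hred : ∀ B ∈ Set.centralizer (Set.range S.π), B * P = P * B * P := by
    intro B hB
    have : (1 - P) * (B * P) = 0 := by
      rw [hsub]
      ext k
      change adjoint J₂ (J₂ (B (adjoint J₁ (J₁ k)))) = 0
      rw [key B hB, map_zero]
    rw [sub_mul, one_mul, sub_eq_zero] at this
    rw [mul_assoc]
    exact this
  have hidem : P * P = P := by simpa using (hred 1 (Set.one_mem_centralizer)).symm
  refine ⟨P, ⟨hidem, hPadj⟩, ?_, ?_, ?_⟩
  · rintro _ ⟨x, rfl⟩
    change S.π x ∘L adjoint J₁ ∘L J₁ = (adjoint J₁ ∘L J₁) ∘L S.π x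
    rw [comp_assoc, hJ₁, ← comp_assoc, ← comp_assoc, hJ₁']
  · intro B hB
    have h1 := congrArg star (hred _ (adjoint_mem_centralizer_range hB))
    simp only [star_mul, star_eq_adjoint, adjoint_adjoint, hPadj] at h1
    exact (hred B hB).trans ((mul_assoc _ _ _).trans h1.symm)
  · intro x
    rw [S₁.apply_eq, ← hV₁, adjoint_comp, hP]
    simp only [comp_assoc]
    rw [← comp_assoc (S₁.π x), ← hJ₁, comp_assoc]

/-- Conversely, a decomposition `T = T₁ + T₂` by a projection in the centre of `π(X)''` has
disjoint summands: if a functional were normal for both representations, its two normal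
extensions to `π(X)''` would agree, but at `P` they take the values `1` and `0`. -/
theorem disjointReps_of_central_projection (S : MinimalStinespring T)
    (S₁ : MinimalStinespring T₁) (S₂ : MinimalStinespring T₂) (hT : ∀ x, T x = T₁ x + T₂ x)
    {P : S.K →L[ℂ] S.K} (hP : IsStarProjection P) (hP' : P ∈ Set.centralizer (Set.range S.π))
    (hP'' : P ∈ Set.centralizer (Set.centralizer (Set.range S.π)))
    (hPT : ∀ x, T₁ x = adjoint S.V ∘L P ∘L S.π x ∘L S.V) : DisjointReps S₁.π S₂.π := by
  obtain ⟨J₁, J₂, hJ₁, hJ₂, hV₁, -, hd₁, hd₂, hsum⟩ := S.exists_intertwiners S₁ S₂ hT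
  have hPJ : P = adjoint J₁ ∘L J₁ := by
    refine S.ext_of_mem_centralizer hP' ?_ fun x => ?_
    · rintro _ ⟨x, rfl⟩
      change S.π x ∘L adjoint J₁ ∘L J₁ = (adjoint J₁ ∘L J₁) ∘L S.π x
      rw [comp_assoc, hJ₁, ← comp_assoc, ← comp_assoc, adjoint_intertwines hJ₁]
    · rw [← hPT, S₁.apply_eq, ← hV₁, adjoint_comp]
      simp only [comp_assoc]
      rw [← comp_assoc (S₁.π x), ← hJ₁, comp_assoc]
  have hPQ : 1 - P = adjoint J₂ ∘L J₂ := by rw [← hsum, hPJ, add_sub_cancel_left]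
  -- `J₁` and `J₂` are partial isometries with initial projections `P` and `1 - P`.
  have hkill : ∀ {L : Type (max u v)} [NormedAddCommGroup L] [InnerProductSpace ℂ L]
      [CompleteSpace L] (J : S.K →L[ℂ] L) (E : S.K →L[ℂ] S.K), (adjoint J ∘L J) * E = 0 →
      ∀ k, J (E k) = 0 := by
    intro L _ _ _ J E hE k
    have : ⟪J (E k), J (E k)⟫_ℂ = 0 := by
      rw [← adjoint_inner_right]
      change ⟪E k, ((adjoint J ∘L J) * E) k⟫_ℂ = 0
      simp [hE]
    exact inner_self_eq_zero.1 this
  have hJ₁P : ∀ k, J₁ (P k) = J₁ k := by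
    intro k
    have := hkill J₁ (1 - P) (by rw [← hPJ]; exact hP.mul_one_sub_self) k
    have h2 : J₁ (k - P k) = 0 := this
    rw [map_sub, sub_eq_zero] at h2
    exact h2.symm
  have hJ₂P : ∀ k, J₂ (P k) = 0 := hkill J₂ P (by rw [← hPQ]; exact hP.one_sub_mul_self)
  have hco₁ : ∀ l, J₁ (adjoint J₁ l) = l := by
    refine fun l => congrFun (hd₁.equalizer (g := fun l => J₁ (adjoint J₁ l)) (h := id)
      (by fun_prop) continuous_id ?_) l
    ext k
    change J₁ ((adjoint J₁ ∘L J₁) k) = J₁ k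
    rw [← hPJ, hJ₁P]
  have hco₂ : ∀ l, J₂ (adjoint J₂ l) = l := by
    refine fun l => congrFun (hd₂.equalizer (g := fun l => J₂ (adjoint J₂ l)) (h := id)
      (by fun_prop) continuous_id ?_) l
    ext k
    change J₂ ((adjoint J₂ ∘L J₂) k) = J₂ k
    rw [← hPQ]
    change J₂ (k - P k) = _
    rw [map_sub, hJ₂P, sub_zero]
  have main : ∀ ω : X →ₗ[ℂ] ℂ, IsNormalFor S₁.π ω → IsNormalFor S₂.π ω → False := by
    rintro ω ⟨ρ₁, hρ₁, h₁⟩ ⟨ρ₂, hρ₂, h₂⟩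
    obtain ⟨σ₁, hσ₁⟩ := ρ₁.exists_trace
    obtain ⟨σ₂, hσ₂⟩ := ρ₂.exists_trace
    have hsx₁ : Summable fun n => ‖adjoint J₁ (σ₁.x n)‖ ^ 2 := summable_norm_sq_map _ σ₁.summable_x
    have hsy₁ : Summable fun n => ‖adjoint J₁ (σ₁.y n)‖ ^ 2 := summable_norm_sq_map _ σ₁.summable_y
    have hsx₂ : Summable fun n => ‖adjoint J₂ (σ₂.x n)‖ ^ 2 := summable_norm_sq_map _ σ₂.summable_x
    have hsy₂ : Summable fun n => ‖adjoint J₂ (σ₂.y n)‖ ^ 2 := summable_norm_sq_map _ σ₂.summable_y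
    -- `τᵢ` is the functional `A ↦ ρᵢ(Jᵢ A Jᵢ*)` on `B(K)`; it extends `ω` along the
    -- representation of `T`.
    let τ₁ : TracePair S.K := ⟨_, _, hsx₁, hsy₁⟩
    let τ₂ : TracePair S.K := ⟨_, _, hsx₂, hsy₂⟩
    have hτ₁ : ∀ A B, (∀ l, J₁ (A (adjoint J₁ l)) = B l) → τ₁.trace A = σ₁.trace B := by
      intro A B hAB
      refine tsum_congr fun n => ?_
      change ⟪adjoint J₁ (σ₁.x n), A (adjoint J₁ (σ₁.y n))⟫_ℂ = _
      rw [adjoint_inner_left, hAB]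
    have hτ₂ : ∀ A B, (∀ l, J₂ (A (adjoint J₂ l)) = B l) → τ₂.trace A = σ₂.trace B := by
      intro A B hAB
      refine tsum_congr fun n => ?_
      change ⟪adjoint J₂ (σ₂.x n), A (adjoint J₂ (σ₂.y n))⟫_ℂ = _
      rw [adjoint_inner_left, hAB]
    have hagree : τ₁.trace P = τ₂.trace P := by
      refine trace_eq_of_mem_bicommutant (s := Set.range S.π) ⟨1, map_one _⟩ ?_ ?_ ?_ hP''
      · rintro _ ⟨x, rfl⟩ _ ⟨y, rfl⟩
        exact ⟨x * y, map_mul _ _ _⟩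
      · rintro _ ⟨x, rfl⟩
        exact ⟨star x, map_star _ _⟩
      · rintro _ ⟨x, rfl⟩
        rw [hτ₁ _ (S₁.π x) fun l => ?_, hτ₂ _ (S₂.π x) fun l => ?_]
        · rw [← hσ₁ ⟨_, mem_bicommutant S₁.π x⟩, ← hσ₂ ⟨_, mem_bicommutant S₂.π x⟩, ← h₁, ← h₂]
        · exact (DFunLike.congr_fun (hJ₂ x) _).trans (congrArg (S₂.π x) (hco₂ l))
        · exact (DFunLike.congr_fun (hJ₁ x) _).trans (congrArg (S₁.π x) (hco₁ l))
    rw [hτ₁ P 1 fun l => by rw [hJ₁P, hco₁]; rfl, hτ₂ P 0 fun l => by rw [hJ₂P]; rfl] at hagree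
    have h1 : σ₁.trace 1 = 1 := (hσ₁ 1).symm.trans hρ₁.2
    have h0 : σ₂.trace 0 = 0 := by simp [TracePair.trace]
    rw [h1, h0] at hagree
    exact one_ne_zero hagree
  exact fun ω _ => ⟨fun h₁ h₂ => main ω h₁ h₂, fun h₂ h₁ => main ω h₁ h₂⟩

end CentralProjection

/-! ### Faithful normal states on σ-finite von Neumann algebras -/

section FaithfulState

variable {H : Type v} [NormedAddCommGroup H] [InnerProductSpace ℂ H] [CompleteSpace H]
  {M : VonNeumannAlgebra H}

/-- The closed cyclic subspace `[M' ξ]` of the commutant. -/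
def commutantCyclic (M : VonNeumannAlgebra H) (ξ : H) : Submodule ℂ H :=
  (Submodule.span ℂ {k | ∃ C ∈ M.commutant, C ξ = k}).topologicalClosure

instance (ξ : H) : CompleteSpace (commutantCyclic M ξ) :=
  (Submodule.isClosed_topologicalClosure _).completeSpace_coe

lemma self_mem_commutantCyclic (ξ : H) : ξ ∈ commutantCyclic M ξ :=
  subset_closure (Submodule.subset_span ⟨1, one_mem _, rfl⟩)

lemma apply_mem_commutantCyclic {C : H →L[ℂ] H} (hC : C ∈ M.commutant) {ξ η : H}
    (hη : η ∈ commutantCyclic M ξ) : C η ∈ commutantCyclic M ξ := by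
  refine map_mem_closure C.continuous hη fun u hu => ?_
  induction hu using Submodule.span_induction with
  | mem u hu =>
    obtain ⟨D, hD, rfl⟩ := hu
    exact Submodule.subset_span ⟨C * D, mul_mem hC hD, rfl⟩
  | zero => simp
  | add a b _ _ ha hb => simpa using add_mem ha hb
  | smul c a _ ha => simpa using Submodule.smul_mem _ c ha

lemma starProjection_commutantCyclic_mem (ξ : H) : (commutantCyclic M ξ).starProjection ∈ M := by
  suffices h : (commutantCyclic M ξ).starProjection ∈ M.commutant.commutant by
    rwa [M.commutant_commutant] at h
  rw [VonNeumannAlgebra.mem_commutant_iff]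
  intro C hC
  have hC' : adjoint C ∈ M.commutant := star_mem (S := VonNeumannAlgebra H) hC
  ext k
  exact (starProjection_comm_of_reducing (commutantCyclic M ξ) C
    (fun _ hη => apply_mem_commutantCyclic hC hη)
    (fun _ hη => apply_mem_commutantCyclic hC' hη) k).symm

lemma isOrtho_commutantCyclic {ξ η : H} (h : ∀ C ∈ M.commutant, ⟪ξ, C η⟫_ℂ = 0) :
    commutantCyclic M ξ ⟂ commutantCyclic M η := by
  refine Submodule.topologicalClosure_minimal _ ?_ (Submodule.isClosed_orthogonal _)
  rw [commutantCyclic, Submodule.orthogonal_closure]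
  refine Submodule.isOrtho_span.2 ?_
  rintro _ ⟨C, hC, rfl⟩ _ ⟨D, hD, rfl⟩
  rw [← adjoint_inner_right]
  exact h _ (mul_mem (star_mem hC) hD)

/-- A σ-finite von Neumann algebra has a countable separating set of unit vectors: take a maximal
set of unit vectors whose cyclic subspaces under the commutant are mutually orthogonal. -/
theorem IsSigmaFinite.exists_separating [Nontrivial H] (hM : IsSigmaFinite M) :
    ∃ e : ℕ → H, (∀ n, ‖e n‖ = 1) ∧ ∀ A ∈ M, (∀ n, A (e n) = 0) → A = 0 := by
  let F : Set (Set H) := {E | (∀ ξ ∈ E, ‖ξ‖ = 1) ∧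
    ∀ ξ ∈ E, ∀ η ∈ E, ξ ≠ η → ∀ C ∈ M.commutant, ⟪ξ, C η⟫_ℂ = 0}
  obtain ⟨E, hE⟩ : ∃ E, Maximal (· ∈ F) E := by
    refine zorn_subset F fun c hc hchain => ⟨⋃₀ c, ⟨?_, ?_⟩, fun s hs => Set.subset_sUnion_of_mem hs⟩
    · rintro ξ ⟨s, hs, hξ⟩
      exact (hc hs).1 ξ hξ
    · rintro ξ ⟨s, hs, hξ⟩ η ⟨t, ht, hη⟩
      rcases hchain.total hs ht with h | h
      · exact (hc ht).2 ξ (h hξ) η hη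
      · exact (hc hs).2 ξ hξ η (h hη)
  have hsep : ∀ A ∈ M, (∀ ξ ∈ E, A ξ = 0) → A = 0 := by
    intro A hA hAE
    by_contra hne
    have hne' : adjoint A ≠ 0 := fun h => hne (by rw [← adjoint_adjoint A, h, map_zero])
    obtain ⟨k₀, hk₀⟩ : ∃ k, adjoint A k ≠ 0 := by
      by_contra! hc
      exact hne' (by ext k; simpa using hc k)
    -- A unit vector in the range of `A*` could be added to `E`.
    obtain ⟨k, hk⟩ : ∃ k, ‖adjoint A k‖ = 1 :=
      ⟨((‖adjoint A k₀‖⁻¹ : ℝ) : ℂ) • k₀, by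
        rw [map_smul, norm_smul, Complex.norm_real, norm_inv, norm_norm,
          inv_mul_cancel₀ (norm_ne_zero_iff.2 hk₀)]⟩
    have horth : ∀ ξ ∈ E, ∀ C ∈ M.commutant, ⟪adjoint A k, C ξ⟫_ℂ = 0 := by
      intro ξ hξ C hC
      have hCA : A (C ξ) = C (A ξ) :=
        DFunLike.congr_fun (VonNeumannAlgebra.mem_commutant_iff.1 hC A hA) ξ
      rw [adjoint_inner_left, hCA, hAE ξ hξ, map_zero, inner_zero_right]
    have hmem : insert (adjoint A k) E ∈ F := by
      refine ⟨?_, ?_⟩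
      · rintro ξ (rfl | hξ)
        exacts [hk, hE.prop.1 ξ hξ]
      · rintro ξ (rfl | hξ) η (rfl | hη) hne C hC
        · exact absurd rfl hne
        · exact horth η hη C hC
        · have := horth ξ hξ _ (star_mem hC)
          rw [star_eq_adjoint, adjoint_inner_right, ← inner_conj_symm, map_eq_zero] at this
          exact this
        · exact hE.prop.2 ξ hξ η hη hne C hC
    have hin : adjoint A k ∈ E := hE.le_of_ge hmem (Set.subset_insert _ _) (Set.mem_insert _ _)
    have := horth _ hin 1 (one_mem _)
    change ⟪adjoint A k, adjoint A k⟫_ℂ = 0 at this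
    rw [inner_self_eq_zero] at this
    rw [this, norm_zero] at hk
    exact zero_ne_one hk
  have horth : ∀ ξ ∈ E, ∀ η ∈ E, ξ ≠ η →
      (commutantCyclic M ξ).starProjection * (commutantCyclic M η).starProjection = 0 :=
    fun ξ hξ η hη hne => Submodule.IsOrtho.starProjection_comp_starProjection
      (isOrtho_commutantCyclic (hE.prop.2 ξ hξ η hη hne))
  have hinj : Set.InjOn (fun ξ => (commutantCyclic M ξ).starProjection) E := by
    intro ξ hξ η hη heq
    by_contra hne
    have h0 := horth ξ hξ η hη hne
    simp only at heq
    rw [← heq, (isStarProjection_starProjection (U := commutantCyclic M ξ)).isIdempotentElem] at h0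
    have h1 := Submodule.starProjection_eq_self_iff.2 (self_mem_commutantCyclic (M := M) ξ)
    rw [h0] at h1
    have h2 := hE.prop.1 ξ hξ
    rw [← h1] at h2
    simp at h2
  have hcount : E.Countable := by
    refine Set.countable_of_injective_of_countable_image hinj (hM _ ?_ ?_)
    · rintro _ ⟨ξ, -, rfl⟩
      exact ⟨starProjection_commutantCyclic_mem ξ, isStarProjection_starProjection⟩
    · rintro _ ⟨ξ, hξ, rfl⟩ _ ⟨η, hη, rfl⟩ hne
      exact horth ξ hξ η hη fun h => hne (by rw [h])
  have hne : E.Nonempty := by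
    by_contra h
    rw [Set.not_nonempty_iff_eq_empty] at h
    exact one_ne_zero (hsep 1 (one_mem _) (by simp [h]))
  obtain ⟨e, rfl⟩ := hcount.exists_eq_range hne
  exact ⟨e, fun n => hE.prop.1 _ ⟨n, rfl⟩, fun A hA h => hsep A hA (by rintro _ ⟨n, rfl⟩; exact h n)⟩

/-- A σ-finite von Neumann algebra on a nonzero Hilbert space has a square summable separating
sequence, normalized so as to induce a state. -/
theorem IsSigmaFinite.exists_square_summable_separating [Nontrivial H] (hM : IsSigmaFinite M) :
    ∃ x : ℕ → H, HasSum (fun n => ‖x n‖ ^ 2) 1 ∧ ∀ A ∈ M, (∀ n, A (x n) = 0) → A = 0 := by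
  obtain ⟨e, he, hsep⟩ := hM.exists_separating
  let x : ℕ → H := fun n => ((Real.sqrt (1 / 2 / 2 ^ n) : ℝ) : ℂ) • e n
  have hx : ∀ n, ‖x n‖ ^ 2 = 1 / 2 / 2 ^ n := by
    intro n
    rw [norm_smul, he, mul_one, Complex.norm_real, Real.norm_eq_abs, sq_abs,
      Real.sq_sqrt (by positivity)]
  refine ⟨x, ?_, fun A hA h => hsep A hA fun n => ?_⟩
  · simp_rw [hx]
    exact hasSum_geometric_two' 1
  · have hn := h n
    rw [map_smul] at hn
    refine (smul_eq_zero.1 hn).resolve_left ?_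
    have : 0 < Real.sqrt (1 / 2 / 2 ^ n) := by positivity
    exact_mod_cast this.ne'

/-- The trace pair of the positive operator `∑ |x n⟩⟨x n|`. -/
def TracePair.diagonal (x : ℕ → H) (hx : Summable fun n => ‖x n‖ ^ 2) : TracePair H :=
  ⟨x, x, hx, hx⟩

omit [CompleteSpace H] in
lemma TracePair.diagonal_inner_nonneg {x : ℕ → H} (hx : Summable fun n => ‖x n‖ ^ 2)
    {A : H →L[ℂ] H} (hA : 0 ≤ A) (n : ℕ) :
    0 ≤ ⟪(TracePair.diagonal x hx).x n, A ((TracePair.diagonal x hx).y n)⟫_ℂ :=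
  inner_apply_nonneg hA (x n)

lemma NormalFunctional.isState_diagonal {x : ℕ → H} (hx : HasSum (fun n => ‖x n‖ ^ 2) 1) :
    (NormalFunctional.ofTracePair M (TracePair.diagonal x hx.summable)).IsState := by
  refine ⟨fun A hA => tsum_nonneg (TracePair.diagonal_inner_nonneg hx.summable hA), ?_⟩
  refine HasSum.tsum_eq ?_
  have := hx.mapL Complex.ofRealCLM
  rw [show Complex.ofRealCLM 1 = 1 by simp] at this
  convert this using 1
  ext n
  change ⟪x n, x n⟫_ℂ = _
  rw [inner_self_eq_norm_sq_to_K]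
  simp

lemma NormalFunctional.isFaithful_diagonal {x : ℕ → H} (hx : Summable fun n => ‖x n‖ ^ 2)
    (hsep : ∀ A ∈ M, (∀ n, A (x n) = 0) → A = 0) :
    (NormalFunctional.ofTracePair M (TracePair.diagonal x hx)).IsFaithful := by
  intro A hA h0
  have hz : ∀ n, ⟪x n, (A : H →L[ℂ] H) (x n)⟫_ℂ = 0 := by
    have h1 := (hasSum_zero_iff_of_nonneg (TracePair.diagonal_inner_nonneg hx hA)).1
      (by rw [← h0]; exact ((TracePair.diagonal x hx).summable_inner A).hasSum)
    exact fun n => congrFun h1 n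
  obtain ⟨B, hB⟩ := exists_star_mul_self_of_nonneg hA
  refine Subtype.ext (hsep A A.2 fun n => ?_)
  have h2 := hz n
  rw [hB] at h2 ⊢
  have h3 : ⟪B (x n), B (x n)⟫_ℂ = 0 := by
    rw [← adjoint_inner_right]
    exact h2
  have h4 : B (x n) = 0 := inner_self_eq_zero.1 h3
  change star B (B (x n)) = 0
  rw [h4, map_zero]

end FaithfulState

/-! ### Bounded measurable functions of a set-indexed family of vectors -/

section BoundedIntegral

variable {S : Type w} [MeasurableSpace S]

/-- `f` is measurable and bounded. -/
def IsBddMeasurable (f : S → ℂ) : Prop := Measurable f ∧ ∃ c, ∀ s, ‖f s‖ ≤ c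

/-- `I` is a linear functional on the bounded measurable functions that is bounded for the
supremum norm. Nothing is required of the values of `I` at other functions. -/
structure IsBoundedIntegral (I : (S → ℂ) → ℂ) : Prop where
  add : ∀ f g, IsBddMeasurable f → IsBddMeasurable g → I (fun s => f s + g s) = I f + I g
  smul : ∀ (c : ℂ) f, IsBddMeasurable f → I (fun s => c * f s) = c * I f
  bound : ∃ C, ∀ f c, Measurable f → (∀ s, ‖f s‖ ≤ c) → ‖I f‖ ≤ C * c

lemma IsBddMeasurable.add {f g : S → ℂ} (hf : IsBddMeasurable f) (hg : IsBddMeasurable g) :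
    IsBddMeasurable fun s => f s + g s := by
  obtain ⟨c, hc⟩ := hf.2
  obtain ⟨d, hd⟩ := hg.2
  exact ⟨hf.1.add hg.1, c + d, fun s => (norm_add_le _ _).trans (add_le_add (hc s) (hd s))⟩

lemma IsBddMeasurable.smul (c : ℂ) {f : S → ℂ} (hf : IsBddMeasurable f) :
    IsBddMeasurable fun s => c * f s := by
  obtain ⟨d, hd⟩ := hf.2
  refine ⟨hf.1.const_mul c, ‖c‖ * d, fun s => ?_⟩
  rw [norm_mul]
  gcongr
  exact hd s

lemma isBddMeasurable_indicator {Δ : Set S} (hΔ : MeasurableSet Δ) :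
    IsBddMeasurable (Δ.indicator fun _ => (1 : ℂ)) := by
  refine ⟨measurable_const.indicator hΔ, 1, fun s => ?_⟩
  by_cases h : s ∈ Δ <;> simp [h]

variable {E : Type*} [NormedAddCommGroup E] [NormedSpace ℂ E]

/-- `A` represents `∫ f dP`: it lies in the closed span of the values of `P`, and every bounded
functional `L` takes the value `∫ f d(L ∘ P)` at `A`, for whatever bounded integral extends
`L ∘ P`. -/
def Represents (P : Set S → E) (f : S → ℂ) (A : E) : Prop :=
  A ∈ (Submodule.span ℂ (P '' {Δ | MeasurableSet Δ})).topologicalClosure ∧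
    ∀ (L : E →L[ℂ] ℂ) (I : (S → ℂ) → ℂ), IsBoundedIntegral I →
      (∀ Δ, MeasurableSet Δ → I (Δ.indicator fun _ => 1) = L (P Δ)) → I f = L A

variable {P : Set S → E}

lemma Represents.add {f g : S → ℂ} {A B : E} (hf : IsBddMeasurable f) (hg : IsBddMeasurable g)
    (hA : Represents P f A) (hB : Represents P g B) :
    Represents P (fun s => f s + g s) (A + B) :=
  ⟨add_mem hA.1 hB.1, fun L I hI h => by
    rw [hI.add f g hf hg, hA.2 L I hI h, hB.2 L I hI h, map_add]⟩

lemma Represents.smul (c : ℂ) {f : S → ℂ} {A : E} (hf : IsBddMeasurable f)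
    (hA : Represents P f A) : Represents P (fun s => c * f s) (c • A) :=
  ⟨Submodule.smul_mem _ c hA.1, fun L I hI h => by
    rw [hI.smul c f hf, hA.2 L I hI h, map_smul, smul_eq_mul]⟩

lemma represents_indicator {Δ : Set S} (hΔ : MeasurableSet Δ) :
    Represents P (Δ.indicator fun _ => 1) (P Δ) :=
  ⟨subset_closure (Submodule.subset_span ⟨Δ, hΔ, rfl⟩), fun _ _ _ h => h Δ hΔ⟩

/-- The doubling map, which shifts the binary digits of a number in `[0, 1]`. -/
noncomputable def binaryShift (t : ℝ) : ℝ := if 1 / 2 ≤ t then 2 * t - 1 else 2 * t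

lemma measurable_binaryShift : Measurable binaryShift :=
  Measurable.ite measurableSet_Ici (by fun_prop) (by fun_prop)

lemma binaryShift_mem {t : ℝ} (ht : t ∈ Set.Icc (0 : ℝ) 1) : binaryShift t ∈ Set.Icc (0 : ℝ) 1 := by
  obtain ⟨h0, h1⟩ := ht
  unfold binaryShift
  split_ifs with h
  · exact ⟨by linarith, by linarith⟩
  · exact ⟨by linarith, by linarith⟩

variable [CompleteSpace E]

/-- A function `u` with values in `[0, 1]` is represented by `∑ 2⁻ⁿ⁻¹ P(Δ n)`, where `Δ n` is the
set on which the `n`-th binary digit of `u` is one. -/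
lemma exists_represents_of_mem_Icc (hP : ∀ Δ, MeasurableSet Δ → ‖P Δ‖ ≤ 1) {u : S → ℝ}
    (hu : Measurable u) (h01 : ∀ s, u s ∈ Set.Icc (0 : ℝ) 1) :
    ∃ A, Represents P (fun s => (u s : ℂ)) A := by
  let g : ℕ → S → ℝ := fun n s => binaryShift^[n] (u s)
  have hg : ∀ n, Measurable (g n) := fun n => (measurable_binaryShift.iterate n).comp hu
  have hg01 : ∀ n s, g n s ∈ Set.Icc (0 : ℝ) 1 := by
    intro n s
    induction n with
    | zero => exact h01 s
    | succ n ih =>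
      change binaryShift^[n + 1] (u s) ∈ _
      rw [Function.iterate_succ_apply']
      exact binaryShift_mem ih
  have hgnorm : ∀ n s, ‖(g n s : ℂ)‖ ≤ 1 := by
    intro n s
    rw [Complex.norm_real, Real.norm_eq_abs, abs_of_nonneg (hg01 n s).1]
    exact (hg01 n s).2
  have hgb : ∀ n, IsBddMeasurable fun s => (g n s : ℂ) := fun n =>
    ⟨Complex.measurable_ofReal.comp (hg n), 1, hgnorm n⟩
  let Δ : ℕ → Set S := fun n => {s | 1 / 2 ≤ g n s}
  have hΔ : ∀ n, MeasurableSet (Δ n) := fun n => measurableSet_le measurable_const (hg n)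
  have hstep : ∀ n s, (g n s : ℂ)
      = (1 / 2 : ℂ) * (Δ n).indicator (fun _ => 1) s + (1 / 2 : ℂ) * (g (n + 1) s : ℂ) := by
    intro n s
    have h1 : g (n + 1) s = binaryShift (g n s) := Function.iterate_succ_apply' _ _ _
    rw [h1, binaryShift]
    by_cases h : 1 / 2 ≤ g n s
    · rw [Set.indicator_of_mem (show s ∈ Δ n from h), if_pos h]
      push_cast
      ring
    · rw [Set.indicator_of_notMem (show s ∉ Δ n from h), if_neg h]
      push_cast
      ring
  have hnorm : ∀ n, ‖((1 / 2 : ℂ) ^ (n + 1)) • P (Δ n)‖ ≤ (1 / 2) ^ (n + 1) := by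
    intro n
    rw [norm_smul, norm_pow]
    simpa using mul_le_mul_of_nonneg_left (hP _ (hΔ n)) (by positivity : (0 : ℝ) ≤ (1 / 2) ^ (n + 1))
  have hsum : Summable fun n => ((1 / 2 : ℂ) ^ (n + 1)) • P (Δ n) :=
    Summable.of_norm_bounded ((summable_nat_add_iff 1).2 summable_geometric_two) hnorm
  refine ⟨∑' n, ((1 / 2 : ℂ) ^ (n + 1)) • P (Δ n), ?_, fun L I hI hL => ?_⟩
  · refine (Submodule.isClosed_topologicalClosure _).mem_of_tendsto hsum.hasSum
      (Filter.Eventually.of_forall fun t => sum_mem fun n _ => Submodule.smul_mem _ _ ?_)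
    exact subset_closure (Submodule.subset_span ⟨_, hΔ n, rfl⟩)
  · have hrec : ∀ n, I (fun s => (g n s : ℂ))
        = (1 / 2 : ℂ) * L (P (Δ n)) + (1 / 2 : ℂ) * I (fun s => (g (n + 1) s : ℂ)) := by
      intro n
      rw [funext (hstep n), hI.add _ _ ((isBddMeasurable_indicator (hΔ n)).smul _)
        ((hgb (n + 1)).smul _), hI.smul _ _ (isBddMeasurable_indicator (hΔ n)),
        hI.smul _ _ (hgb (n + 1)), hL _ (hΔ n)]
    have hpartial : ∀ n, I (fun s => (u s : ℂ))
        = ∑ i ∈ Finset.range n, L (((1 / 2 : ℂ) ^ (i + 1)) • P (Δ i))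
          + (1 / 2 : ℂ) ^ n * I (fun s => (g n s : ℂ)) := by
      intro n
      induction n with
      | zero => simp [g]
      | succ n ih =>
        rw [ih, hrec n, Finset.sum_range_succ, map_smul, smul_eq_mul]
        ring
    obtain ⟨C, hC⟩ := hI.bound
    have hrest : Filter.Tendsto (fun n => (1 / 2 : ℂ) ^ n * I (fun s => (g n s : ℂ)))
        Filter.atTop (nhds 0) := by
      refine squeeze_zero_norm (a := fun n => (1 / 2 : ℝ) ^ n * (C * 1)) (fun n => ?_) ?_
      · rw [norm_mul, norm_pow]
        simpa using mul_le_mul_of_nonneg_left (hC _ 1 (hgb n).1 (hgnorm n))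
          (by positivity : (0 : ℝ) ≤ (1 / 2) ^ n)
      · simpa using (tendsto_pow_atTop_nhds_zero_of_lt_one (by norm_num : (0 : ℝ) ≤ 1 / 2)
          (by norm_num)).mul_const (C * 1)
    have hlim := ((hsum.hasSum.mapL L).tendsto_sum_nat).add hrest
    rw [add_zero] at hlim
    refine tendsto_nhds_unique ?_ hlim
    simp_rw [← hpartial]
    exact tendsto_const_nhds

/-- Every bounded measurable function has an integral with respect to a family of norm at
most one. -/
theorem exists_represents (hP : ∀ Δ, MeasurableSet Δ → ‖P Δ‖ ≤ 1) {f : S → ℂ}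
    (hf : IsBddMeasurable f) : ∃ A, Represents P f A := by
  obtain ⟨hfm, c₀, hc₀⟩ := hf
  obtain ⟨c, hcpos, hc⟩ : ∃ c : ℝ, 0 < c ∧ ∀ s, ‖f s‖ ≤ c :=
    ⟨max c₀ 1, by positivity, fun s => (hc₀ s).trans (le_max_left _ _)⟩
  -- An affine change of variables reduces a real function to one with values in `[0, 1]`.
  have hreal : ∀ u : S → ℝ, Measurable u → (∀ s, |u s| ≤ c) →
      ∃ A, Represents P (fun s => (u s : ℂ)) A := by
    intro u hu huc
    have hv : ∀ s, (u s / c + 1) / 2 ∈ Set.Icc (0 : ℝ) 1 := by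
      intro s
      have h1 := abs_le.1 (huc s)
      have h2 : u s / c ≤ 1 := (div_le_one hcpos).2 h1.2
      have h3 : -1 ≤ u s / c := by rw [le_div_iff₀ hcpos]; linarith
      exact ⟨by linarith, by linarith⟩
    have hvm : Measurable fun s => (u s / c + 1) / 2 := by fun_prop
    obtain ⟨A, hA⟩ := exists_represents_of_mem_Icc hP hvm hv
    have hvb : IsBddMeasurable fun s => (((u s / c + 1) / 2 : ℝ) : ℂ) := by
      refine ⟨Complex.measurable_ofReal.comp hvm, 1, fun s => ?_⟩
      rw [Complex.norm_real, Real.norm_eq_abs, abs_of_nonneg (hv s).1]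
      exact (hv s).2
    have hone := isBddMeasurable_indicator (S := S) MeasurableSet.univ
    have := (hA.smul (2 * c) hvb).add (hvb.smul _) (hone.smul (-c))
      ((represents_indicator (P := P) MeasurableSet.univ).smul (-c) hone)
    refine ⟨(2 * c : ℂ) • A + (-c : ℂ) • P Set.univ, ?_⟩
    convert this using 2 with s
    have hc0 : (c : ℂ) ≠ 0 := by exact_mod_cast hcpos.ne'
    simp only [Set.indicator_univ]
    push_cast
    field_simp
    ring
  obtain ⟨A, hA⟩ := hreal (fun s => (f s).re) (Complex.measurable_re.comp hfm)
    fun s => (Complex.abs_re_le_norm _).trans (hc s)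
  obtain ⟨B, hB⟩ := hreal (fun s => (f s).im) (Complex.measurable_im.comp hfm)
    fun s => (Complex.abs_im_le_norm _).trans (hc s)
  have hre : IsBddMeasurable fun s => ((f s).re : ℂ) :=
    ⟨Complex.measurable_ofReal.comp (Complex.measurable_re.comp hfm), c, fun s => by
      rw [Complex.norm_real]; exact (Complex.abs_re_le_norm _).trans (hc s)⟩
  have him : IsBddMeasurable fun s => ((f s).im : ℂ) :=
    ⟨Complex.measurable_ofReal.comp (Complex.measurable_im.comp hfm), c, fun s => by
      rw [Complex.norm_real]; exact (Complex.abs_im_le_norm _).trans (hc s)⟩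
  have := hA.add hre (him.smul Complex.I) (hB.smul Complex.I him)
  refine ⟨A + Complex.I • B, ?_⟩
  convert this using 2 with s
  rw [mul_comm]
  exact (Complex.re_add_im _).symm

end BoundedIntegral

/-! ### Integration against complex measures -/

section ComplexMeasure

variable {S : Type w} [MeasurableSpace S]

/-- A complex measure has finite total variation. -/
instance isFiniteMeasure_variation (m : ComplexMeasure S) : IsFiniteMeasure m.variation := by
  refine isFiniteMeasure_of_le
    ((ComplexMeasure.re m).totalVariation + (ComplexMeasure.im m).totalVariation)
    (VectorMeasure.variation_le_of_forall_enorm_le fun Δ hΔ => ?_)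
  have h : m Δ = ((ComplexMeasure.re m Δ : ℝ) : ℂ) + ((ComplexMeasure.im m Δ : ℝ) : ℂ) * Complex.I :=
    (Complex.re_add_im (m Δ)).symm
  rw [h, Measure.add_apply]
  refine (enorm_add_le _ _).trans (add_le_add ?_ ?_)
  · rw [← ofReal_norm, Complex.norm_real, ofReal_norm]
    exact SignedMeasure.enorm_le_totalVariation _ _
  · rw [← ofReal_norm, norm_mul, Complex.norm_I, mul_one, Complex.norm_real, ofReal_norm]
    exact SignedMeasure.enorm_le_totalVariation _ _

lemma IsBddMeasurable.integrable {f : S → ℂ} (hf : IsBddMeasurable f) (ν : Measure S)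
    [IsFiniteMeasure ν] : Integrable f ν := by
  obtain ⟨c, hc⟩ := hf.2
  exact Integrable.of_bound hf.1.aestronglyMeasurable c (Filter.Eventually.of_forall hc)

/-- Integration against a complex measure. -/
lemma isBoundedIntegral_integral (m : ComplexMeasure S) :
    IsBoundedIntegral fun f => m.integral f (ContinuousLinearMap.mul ℝ ℂ) where
  add f g hf hg := VectorMeasure.integral_fun_add (hf.integrable _) (hg.integrable _)
  smul c f hf := by
    simp only [VectorMeasure.integral_eq_setToFun]
    refine setToFun_smul _ (fun c s x => ?_) c f
    rw [transpose_eq_cbmApplyMeasure, cbmApplyMeasure_apply, cbmApplyMeasure_apply]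
    simp [mul_assoc]
  bound := ⟨‖ContinuousLinearMap.mul ℝ ℂ‖ * m.variation.real Set.univ, fun f c _ hc => by
    refine (VectorMeasure.norm_integral_le_of_norm_le_const
      (Filter.Eventually.of_forall hc)).trans (le_of_eq ?_)
    ring⟩

lemma integral_indicator_one (m : ComplexMeasure S) {Δ : Set S} (hΔ : MeasurableSet Δ) :
    m.integral (Δ.indicator fun _ => 1) (ContinuousLinearMap.mul ℝ ℂ) = m Δ := by
  rw [VectorMeasure.integral_eq_setToFun, setToFun_indicator_const _ hΔ (measure_ne_top _ _),
    transpose_eq_cbmApplyMeasure, cbmApplyMeasure_apply]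
  simp

/-- Integration over a set against a finite positive measure. -/
lemma isBoundedIntegral_setIntegral (ν : Measure S) [IsFiniteMeasure ν] (Δ : Set S) :
    IsBoundedIntegral fun f => ∫ s in Δ, f s ∂ν where
  add f g hf hg := integral_add (hf.integrable _) (hg.integrable _)
  smul c f _ := integral_const_mul c f
  bound := ⟨(ν.restrict Δ).real Set.univ, fun f c _ hc => by
    rw [mul_comm]
    exact norm_integral_le_of_norm_le_const (Filter.Eventually.of_forall hc)⟩

/-- A complex measure that is dominated by a finite positive measure has a bounded density. -/
theorem exists_bounded_density (ν : Measure S) [IsFiniteMeasure ν] (m : ComplexMeasure S)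
    (C : NNReal) (h : ∀ Δ, MeasurableSet Δ → ‖m Δ‖ₑ ≤ C * ν Δ) :
    ∃ f : S → ℂ, IsBddMeasurable f ∧ ∀ Δ, MeasurableSet Δ → m Δ = ∫ s in Δ, f s ∂ν := by
  have hac : ∀ (t : SignedMeasure S), (∀ Δ, MeasurableSet Δ → ‖t Δ‖ₑ ≤ ‖m Δ‖ₑ) →
      ν.withDensityᵥ (t.rnDeriv ν) = t := by
    intro t ht
    refine SignedMeasure.withDensityᵥ_rnDeriv_eq t ν
      (VectorMeasure.AbsolutelyContinuous.mk fun Δ hΔ h0 => ?_)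
    rw [Measure.toENNRealVectorMeasure_apply_measurable hΔ] at h0
    have := (ht Δ hΔ).trans (h Δ hΔ)
    rw [h0, mul_zero] at this
    exact enorm_eq_zero.1 (le_antisymm this zero_le)
  have hre := hac (ComplexMeasure.re m) fun Δ _ => by
    rw [← ofReal_norm, ← ofReal_norm]
    exact ENNReal.ofReal_le_ofReal (Complex.abs_re_le_norm _)
  have him := hac (ComplexMeasure.im m) fun Δ _ => by
    rw [← ofReal_norm, ← ofReal_norm]
    exact ENNReal.ofReal_le_ofReal (Complex.abs_im_le_norm _)
  set a := (ComplexMeasure.re m).rnDeriv ν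
  set b := (ComplexMeasure.im m).rnDeriv ν
  have hai : Integrable a ν := SignedMeasure.integrable_rnDeriv _ _
  have hbi : Integrable b ν := SignedMeasure.integrable_rnDeriv _ _
  have hai' : Integrable (fun s => (a s : ℂ)) ν := hai.ofReal
  have hbi' : Integrable (fun s => (b s : ℂ)) ν := hbi.ofReal
  let f₀ : S → ℂ := fun s => (a s : ℂ) + (b s : ℂ) * Complex.I
  have hf₀m : Measurable f₀ :=
    (Complex.measurable_ofReal.comp (SignedMeasure.measurable_rnDeriv _ _)).add
      ((Complex.measurable_ofReal.comp (SignedMeasure.measurable_rnDeriv _ _)).mul_const _)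
  have hf₀i : Integrable f₀ ν := hai'.add (hbi'.mul_const _)
  have hm : ∀ Δ, MeasurableSet Δ → m Δ = ∫ s in Δ, f₀ s ∂ν := by
    intro Δ hΔ
    have h1 := integral_add (μ := ν.restrict Δ) hai'.restrict
      (hbi'.mul_const Complex.I).restrict
    refine Eq.trans ?_ h1.symm
    rw [integral_mul_const, integral_complex_ofReal, integral_complex_ofReal,
      ← withDensityᵥ_apply hai hΔ, ← withDensityᵥ_apply hbi hΔ, hre, him]
    exact (Complex.re_add_im (m Δ)).symm
  have hmeq : ν.withDensityᵥ f₀ = m := by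
    ext Δ hΔ
    rw [withDensityᵥ_apply hf₀i hΔ, hm Δ hΔ]
  -- The modulus of the density is the density of the total variation.
  have hvar := Measure.variation_withDensityᵥ hf₀i
  have hle : (fun s => ‖f₀ s‖ₑ) ≤ᵐ[ν] fun _ => (C : ℝ≥0∞) := by
    refine ae_le_of_forall_setLIntegral_le_of_sigmaFinite hf₀m.enorm fun Δ hΔ _ => ?_
    rw [← withDensity_apply _ hΔ, ← hvar, hmeq, setLIntegral_const]
    exact VectorMeasure.variation_le_of_forall_enorm_le (m := C • ν)
      (fun Δ hΔ => h Δ hΔ) Δ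
  let G : Set S := {s | ‖f₀ s‖ₑ ≤ C}
  have hG : MeasurableSet G := measurableSet_le hf₀m.enorm measurable_const
  refine ⟨G.indicator f₀, ⟨hf₀m.indicator hG, C, fun s => ?_⟩, fun Δ hΔ => ?_⟩
  · by_cases hs : s ∈ G
    · rw [Set.indicator_of_mem hs]
      exact enorm_le_coe.1 hs
    · simp [Set.indicator_of_notMem hs]
  · rw [hm Δ hΔ]
    refine integral_congr_ae (ae_restrict_of_ae ?_)
    filter_upwards [hle] with s hs
    rw [Set.indicator_of_mem (show s ∈ G from hs)]

end ComplexMeasure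

/-! ### The von Neumann algebra generated by a projection valued measure -/

section ProjectionValued

variable {S : Type w} [MeasurableSpace S]
  {K : Type v} [NormedAddCommGroup K] [InnerProductSpace ℂ K] [CompleteSpace K]

/-- A finitely additive projection valued measure on the measurable sets. -/
structure IsProjectionMeasure (P : Set S → K →L[ℂ] K) : Prop where
  proj : ∀ Δ, MeasurableSet Δ → IsStarProjection (P Δ)
  univ : P Set.univ = 1
  inter : ∀ Δ Δ', MeasurableSet Δ → MeasurableSet Δ' → P (Δ ∩ Δ') = P Δ * P Δ'
  union : ∀ Δ Δ', MeasurableSet Δ → MeasurableSet Δ' → Disjoint Δ Δ' → P (Δ ∪ Δ') = P Δ + P Δ'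

variable {P : Set S → K →L[ℂ] K}

lemma IsProjectionMeasure.adjoint_eq (hP : IsProjectionMeasure P) {Δ : Set S}
    (hΔ : MeasurableSet Δ) : adjoint (P Δ) = P Δ := (hP.proj Δ hΔ).isSelfAdjoint

lemma IsProjectionMeasure.norm_le (hP : IsProjectionMeasure P) (Δ : Set S)
    (hΔ : MeasurableSet Δ) : ‖P Δ‖ ≤ 1 := (hP.proj Δ hΔ).norm_le

lemma IsProjectionMeasure.commute (hP : IsProjectionMeasure P) {Δ Δ' : Set S}
    (hΔ : MeasurableSet Δ) (hΔ' : MeasurableSet Δ') : P Δ * P Δ' = P Δ' * P Δ := by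
  rw [← hP.inter Δ Δ' hΔ hΔ', ← hP.inter Δ' Δ hΔ' hΔ, Set.inter_comm]

lemma IsProjectionMeasure.inner_apply (hP : IsProjectionMeasure P) {Δ : Set S}
    (hΔ : MeasurableSet Δ) (k : K) : ⟪k, P Δ k⟫_ℂ = ((‖P Δ k‖ ^ 2 : ℝ) : ℂ) := by
  have h : P Δ k = P Δ (P Δ k) := DFunLike.congr_fun (hP.proj Δ hΔ).isIdempotentElem.symm k
  rw [h, ← adjoint_inner_left, hP.adjoint_eq hΔ, ← h, inner_self_eq_norm_sq_to_K]
  simp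

/-- The values of `P` on the measurable sets. -/
def IsProjectionMeasure.values (_ : IsProjectionMeasure P) : Set (K →L[ℂ] K) :=
  P '' {Δ | MeasurableSet Δ}

/-- The von Neumann algebra `P(S)''`. -/
noncomputable def IsProjectionMeasure.algebra (hP : IsProjectionMeasure P) :
    VonNeumannAlgebra K where
  toStarSubalgebra := StarSubalgebra.centralizer ℂ
    (StarSubalgebra.centralizer ℂ hP.values : Set (K →L[ℂ] K))
  centralizer_centralizer' := by
    change Set.centralizer (Set.centralizer (StarSubalgebra.centralizer ℂ
      (StarSubalgebra.centralizer ℂ hP.values : Set (K →L[ℂ] K)) : Set (K →L[ℂ] K))) =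
      (StarSubalgebra.centralizer ℂ
        (StarSubalgebra.centralizer ℂ hP.values : Set (K →L[ℂ] K)) : Set (K →L[ℂ] K))
    simp only [StarSubalgebra.coe_centralizer]
    simp

lemma IsProjectionMeasure.coe_algebra (hP : IsProjectionMeasure P) :
    (hP.algebra : Set (K →L[ℂ] K)) = Set.centralizer (Set.centralizer hP.values) := by
  have h : star hP.values = hP.values := by
    refine Set.Subset.antisymm ?_ ?_
    · rintro A ⟨Δ, hΔ, hA⟩
      exact ⟨Δ, hΔ, by rw [← star_star A, ← hA]; exact (hP.adjoint_eq hΔ).symm⟩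
    · rintro _ ⟨Δ, hΔ, rfl⟩
      exact ⟨Δ, hΔ, (hP.adjoint_eq hΔ).symm⟩
  change (StarSubalgebra.centralizer ℂ
    (StarSubalgebra.centralizer ℂ hP.values : Set (K →L[ℂ] K)) : Set (K →L[ℂ] K)) = _
  rw [StarSubalgebra.coe_centralizer_centralizer, h, Set.union_self]

lemma IsProjectionMeasure.mem_algebra_iff (hP : IsProjectionMeasure P) {A : K →L[ℂ] K} :
    A ∈ hP.algebra ↔ A ∈ Set.centralizer (Set.centralizer hP.values) := by
  rw [← hP.coe_algebra]
  rfl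

lemma IsProjectionMeasure.apply_mem_algebra (hP : IsProjectionMeasure P) {Δ : Set S}
    (hΔ : MeasurableSet Δ) : P Δ ∈ hP.algebra :=
  hP.mem_algebra_iff.2 (Set.subset_centralizer_centralizer ⟨Δ, hΔ, rfl⟩)

lemma IsProjectionMeasure.algebra_comm (hP : IsProjectionMeasure P) {A B : K →L[ℂ] K}
    (hA : A ∈ hP.algebra) (hB : B ∈ hP.algebra) : A * B = B * A := by
  have h1 : hP.values ⊆ Set.centralizer hP.values := by
    rintro _ ⟨Δ, hΔ, rfl⟩ _ ⟨Δ', hΔ', rfl⟩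
    exact hP.commute hΔ' hΔ
  rw [hP.mem_algebra_iff] at hA hB
  exact hB A (Set.centralizer_subset h1 hA)

lemma IsProjectionMeasure.mem_algebra_of_represents (hP : IsProjectionMeasure P) {f : S → ℂ}
    {A : K →L[ℂ] K} (hA : Represents P f A) : A ∈ hP.algebra := by
  have hclosed : IsClosed (hP.algebra : Set (K →L[ℂ] K)) := by
    rw [hP.coe_algebra]
    exact Set.isClosed_centralizer _
  have hle : Submodule.span ℂ (P '' {Δ | MeasurableSet Δ})
      ≤ hP.algebra.toStarSubalgebra.toSubalgebra.toSubmodule := by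
    refine Submodule.span_le.2 ?_
    rintro _ ⟨Δ, hΔ, rfl⟩
    exact hP.apply_mem_algebra hΔ
  exact closure_minimal hle hclosed hA.1

/-- The double commutant theorem for `P(S)''`. -/
lemma IsProjectionMeasure.tsum_inner_eq_zero (hP : IsProjectionMeasure P) {ι : Type*}
    {x y : ι → K} (hx : Summable fun i => ‖x i‖ ^ 2) (hy : Summable fun i => ‖y i‖ ^ 2)
    (h : ∀ Δ, MeasurableSet Δ → ∑' i, ⟪x i, P Δ (y i)⟫_ℂ = 0) {A : K →L[ℂ] K}
    (hA : A ∈ hP.algebra) : ∑' i, ⟪x i, A (y i)⟫_ℂ = 0 := by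
  refine tsum_inner_eq_zero_of_mem_bicommutant (s := hP.values) ⟨_, MeasurableSet.univ, hP.univ⟩
    ?_ ?_ hx hy ?_ (hP.mem_algebra_iff.1 hA)
  · rintro _ ⟨Δ, hΔ, rfl⟩ _ ⟨Δ', hΔ', rfl⟩
    exact ⟨Δ ∩ Δ', MeasurableSet.inter hΔ hΔ', hP.inter Δ Δ' hΔ hΔ'⟩
  · rintro _ ⟨Δ, hΔ, rfl⟩
    exact ⟨Δ, hΔ, (hP.adjoint_eq hΔ).symm⟩
  · rintro _ ⟨Δ, hΔ, rfl⟩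
    exact h Δ hΔ

/-- If a square summable sequence of vectors `k` is separating for `P(S)''` and
`ν(Δ) = ∑ ‖P(Δ) k n‖²` is countably additive, then every `A ∈ P(S)''` is of the form `∫ f dP` with
`f` bounded: `f` is the density of `Δ ↦ ∑ ⟨k n, A P(Δ) k n⟩` with respect to `ν`. -/
theorem IsProjectionMeasure.exists_represents_of_mem_algebra (hP : IsProjectionMeasure P)
    {k : ℕ → K} (hk : Summable fun n => ‖k n‖ ^ 2) {ν : Measure S} [IsFiniteMeasure ν]
    (hν : ∀ Δ, MeasurableSet Δ → ν.real Δ = ∑' n, ‖P Δ (k n)‖ ^ 2)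
    (hsep : ∀ D ∈ hP.algebra, (∀ n, D (k n) = 0) → D = 0) {A : K →L[ℂ] K}
    (hA : A ∈ hP.algebra) : ∃ f, IsBddMeasurable f ∧ Represents P f A := by
  classical
  -- `τ Δ` is the functional `B ↦ ∑ ⟨k n, B P(Δ) k n⟩`.
  let τ : Set S → TracePair K := fun Δ => ⟨k, fun n => P Δ (k n), hk, summable_norm_sq_map _ hk⟩
  have hτP : ∀ Δ Δ', MeasurableSet Δ → MeasurableSet Δ' →
      (τ Δ).trace (P Δ') = (ν.real (Δ' ∩ Δ) : ℂ) := by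
    intro Δ Δ' hΔ hΔ'
    rw [hν _ (hΔ'.inter hΔ), Complex.ofReal_tsum]
    refine tsum_congr fun n => ?_
    rw [← hP.inner_apply (hΔ'.inter hΔ), hP.inter _ _ hΔ' hΔ]
    rfl
  have hcomm : ∀ Δ, MeasurableSet Δ → ∀ l, A (P Δ l) = P Δ (A (P Δ l)) := by
    intro Δ hΔ l
    have h1 := DFunLike.congr_fun (hP.algebra_comm hA (hP.apply_mem_algebra hΔ)) (P Δ l)
    have h2 : P Δ (P Δ l) = P Δ l := DFunLike.congr_fun (hP.proj Δ hΔ).isIdempotentElem l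
    exact (congrArg A h2).symm.trans h1
  let m₀ : Set S → ℂ := fun Δ => if MeasurableSet Δ then (τ Δ).trace A else 0
  have hbound : ∀ Δ, ‖m₀ Δ‖ₑ ≤ (‖A‖₊ • ν) Δ := by
    intro Δ
    by_cases hΔ : MeasurableSet Δ
    swap
    · simp [m₀, hΔ]
    have hnorm : ‖m₀ Δ‖ ≤ ‖A‖ * ν.real Δ := by
      simp only [m₀, if_pos hΔ]
      refine (norm_tsum_le_tsum_norm ((τ Δ).summable_norm_inner A)).trans ?_
      rw [hν Δ hΔ, ← tsum_mul_left]
      refine ((τ Δ).summable_norm_inner A).tsum_le_tsum (fun n => ?_)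
        ((summable_norm_sq_map _ hk).mul_left _)
      change ‖⟪k n, A (P Δ (k n))⟫_ℂ‖ ≤ _
      rw [hcomm Δ hΔ, ← adjoint_inner_left, hP.adjoint_eq hΔ]
      refine (norm_inner_le_norm _ _).trans ?_
      have := A.le_opNorm (P Δ (k n))
      nlinarith [norm_nonneg (P Δ (k n))]
    rw [← ofReal_norm]
    refine (ENNReal.ofReal_le_ofReal hnorm).trans (le_of_eq ?_)
    rw [ENNReal.ofReal_mul (norm_nonneg _), ofReal_measureReal, ofReal_norm]
    rfl
  have hadd : ∀ Δ Δ', MeasurableSet Δ → MeasurableSet Δ' → Disjoint Δ Δ' →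
      m₀ (Δ ∪ Δ') = m₀ Δ + m₀ Δ' := by
    intro Δ Δ' hΔ hΔ' hd
    simp only [m₀, if_pos hΔ, if_pos hΔ', if_pos (hΔ.union hΔ')]
    refine Eq.trans ?_ (((τ Δ).summable_inner A).tsum_add ((τ Δ').summable_inner A))
    refine tsum_congr fun n => ?_
    change ⟪k n, A (P (Δ ∪ Δ') (k n))⟫_ℂ = ⟪k n, A (P Δ (k n))⟫_ℂ + ⟪k n, A (P Δ' (k n))⟫_ℂ
    rw [hP.union Δ Δ' hΔ hΔ' hd, add_apply, map_add, inner_add_right]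
  let m : ComplexMeasure S :=
    VectorMeasure.of_additive_of_le_measure m₀ hbound hadd fun Δ hΔ => if_neg hΔ
  have hm : ∀ Δ, MeasurableSet Δ → m Δ = (τ Δ).trace A := fun Δ hΔ => if_pos hΔ
  obtain ⟨f, hf, hfm⟩ := exists_bounded_density ν m ‖A‖₊ fun Δ _ => hbound Δ
  obtain ⟨B, hB⟩ := exists_represents hP.norm_le hf
  have hBmem := hP.mem_algebra_of_represents hB
  have hBA : ∀ Δ, MeasurableSet Δ → (τ Δ).trace B = (τ Δ).trace A := by
    intro Δ hΔ
    rw [← hm Δ hΔ, hfm Δ hΔ]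
    refine (hB.2 (τ Δ).traceCLM _ (isBoundedIntegral_setIntegral ν Δ) fun Δ' hΔ' => ?_).symm
    rw [TracePair.traceCLM_apply, hτP Δ Δ' hΔ hΔ', integral_indicator hΔ',
      Measure.restrict_restrict hΔ', integral_const]
    simp
  -- `D = B - A` satisfies `∑ ⟨D* k n, P(Δ) k n⟩ = 0` for all `Δ`, hence `∑ ‖D* k n‖² = 0`.
  have hD : B - A ∈ hP.algebra := sub_mem hBmem hA
  have hDadj : adjoint (B - A) ∈ hP.algebra := star_mem (S := VonNeumannAlgebra K) hD
  have hsD : Summable fun n => ‖adjoint (B - A) (k n)‖ ^ 2 := summable_norm_sq_map _ hk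
  have h0 := hP.tsum_inner_eq_zero hsD hk (fun Δ hΔ => by
    have h1 : (τ Δ).traceCLM (B - A) = 0 := by
      rw [map_sub, TracePair.traceCLM_apply, TracePair.traceCLM_apply, hBA Δ hΔ, sub_self]
    rw [← h1]
    exact tsum_congr fun n => adjoint_inner_left _ _ _) hDadj
  have h1 : ∑' n, ‖adjoint (B - A) (k n)‖ ^ 2 = 0 := by
    have h2 : ((∑' n, ‖adjoint (B - A) (k n)‖ ^ 2 : ℝ) : ℂ) = 0 := by
      rw [← h0, Complex.ofReal_tsum]
      refine tsum_congr fun n => ?_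
      rw [inner_self_eq_norm_sq_to_K]
      simp
    exact_mod_cast h2
  have h2 : adjoint (B - A) = 0 := by
    refine hsep _ hDadj fun n => ?_
    have h3 := congrFun ((hasSum_zero_iff_of_nonneg fun n => sq_nonneg _).1
      (h1 ▸ hsD.hasSum)) n
    exact norm_eq_zero.1 (pow_eq_zero_iff two_ne_zero |>.1 h3)
  have h3 : B = A := by
    rw [← sub_eq_zero, ← adjoint_adjoint (B - A), h2, map_zero]
  exact ⟨f, hf, h3 ▸ hB⟩

end ProjectionValued

/-! ### The relative commutant -/

section RelativeCommutant

variable {X : Type u} [CStarAlgebra X] [PartialOrder X] [StarOrderedRing X]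
  {H : Type v} [NormedAddCommGroup H] [InnerProductSpace ℂ H] [CompleteSpace H]
  {M : VonNeumannAlgebra H}

omit [CompleteSpace H] in
lemma continuous_trace_sigmaWeak (σ : TracePair H) :
    @Continuous _ _ (sigmaWeakTopology H) _ fun A : H →L[ℂ] H => σ.trace A :=
  @Continuous.comp _ _ _ (sigmaWeakTopology H) _ _ _ _ (continuous_apply σ) continuous_induced_dom

omit [CompleteSpace H] in
lemma closure_subset_sigmaWeakClosure (s : Set (H →L[ℂ] H)) : closure s ⊆ sigmaWeakClosure s := by
  refine closure.mono ?_
  rw [← continuous_iff_le_induced]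
  exact continuous_pi fun σ => σ.traceCLM.continuous

namespace CPMap

lemma ext_apply {T₁ T₂ : CPMap X M} (h : ∀ x, T₁.toLinearMap x = T₂.toLinearMap x) : T₁ = T₂ := by
  obtain ⟨⟨L₁, h₁⟩, h₁'⟩ := T₁
  obtain ⟨⟨L₂, h₂⟩, h₂'⟩ := T₂
  obtain rfl : L₁ = L₂ := LinearMap.ext h
  rfl

lemma apply_eq_compress (T : CPMap X M) (x : X) :
    T.toLinearMap x = adjoint T.V ∘L T.π x ∘L T.V :=
  (stinespring T.toCompletelyPositiveMap).apply_eq x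

lemma nonneg_apply_one (T : CPMap X M) : 0 ≤ T.toLinearMap 1 := by
  rw [apply_eq_compress, map_one, nonneg_iff_isPositive]
  exact isPositive_adjoint_comp_self T.V

/-- A completely positive map vanishes if it vanishes at `1 = π(1)`, because then `V* V = 0`. -/
lemma apply_eq_zero (T : CPMap X M) (h : T.toLinearMap 1 = 0) (x : X) : T.toLinearMap x = 0 := by
  have hV : ∀ k, T.V k = 0 := by
    intro k
    have h1 : ⟪T.V k, T.V k⟫_ℂ = 0 := by
      rw [apply_eq_compress, map_one] at h
      rw [← adjoint_inner_right]
      have h2 : adjoint T.V (T.V k) = 0 := DFunLike.congr_fun h k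
      rw [h2, inner_zero_right]
    exact inner_self_eq_zero.1 h1
  rw [apply_eq_compress]
  ext k
  change adjoint T.V (T.π x (T.V k)) = 0
  rw [hV, map_zero, map_zero]

/-- The commutant is σ-weakly closed. -/
lemma relCommutant_subset_centralizer (T : CPMap X M) :
    T.relCommutant ⊆ Set.centralizer (Set.range T.π) := by
  rintro A hA _ ⟨x, rfl⟩
  ext l
  refine ext_inner_left ℂ fun k => ?_
  let Z : Set (T.K →L[ℂ] T.K) := {B | (TracePair.rankOne (adjoint (T.π x) k) l).trace B
    = (TracePair.rankOne k (T.π x l)).trace B}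
  have hZ : @IsClosed _ (sigmaWeakTopology T.K) Z :=
    @isClosed_eq _ _ _ (sigmaWeakTopology T.K) _ _ _ (continuous_trace_sigmaWeak _)
      (continuous_trace_sigmaWeak _)
  have hmem : A ∈ Z := by
    refine @closure_minimal _ (sigmaWeakTopology T.K) _ _ (fun B hB => ?_) hZ _ hA
    have hB' : B ∈ (Subalgebra.centralizer ℂ (Set.range T.π)).toSubmodule :=
      (Submodule.span_le (p := (Subalgebra.centralizer ℂ (Set.range T.π)).toSubmodule)).2
        (fun C hC => hC.1) hB
    change TracePair.trace _ _ = TracePair.trace _ _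
    rw [TracePair.trace_rankOne, TracePair.trace_rankOne, adjoint_inner_left]
    exact congrArg _ (DFunLike.congr_fun (hB' _ ⟨x, rfl⟩) l)
  have h := hmem
  change TracePair.trace _ _ = TracePair.trace _ _ at h
  rwa [TracePair.trace_rankOne, TracePair.trace_rankOne, adjoint_inner_left] at h

/-- The norm closure of the span of implementing operators already lies in `π_T(X)^c`, as the norm
topology is finer than the σ-weak one. -/
lemma span_closure_subset_relCommutant (T : CPMap X M) {s : Set (T.K →L[ℂ] T.K)}
    (hs : ∀ R ∈ s, R ∈ Set.centralizer (Set.range T.π) ∧ 0 ≤ R ∧ R ≤ 1 ∧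
      ∃ T' : CPMap X M, ∀ x, T'.toLinearMap x = T.compress R x) {A : T.K →L[ℂ] T.K}
    (hA : A ∈ (Submodule.span ℂ s).topologicalClosure) : A ∈ T.relCommutant :=
  closure_subset_sigmaWeakClosure _ (closure_mono (Submodule.span_mono hs) hA)

lemma orthogonal_iff {T T₁ T₂ : CPMap X M} (h : T₁ + T₂ = T) :
    T₁.Orthogonal T₂ ↔ ∃ P ∈ T.relCommutant, IsStarProjection P ∧
      ∀ x, T₁.toLinearMap x = T.compress P x ∧ T₂.toLinearMap x = T.compress (1 - P) x := by
  subst h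
  rfl

end CPMap

end RelativeCommutant

/-! ### Completely positive measures -/

section CPMeasures

variable {X : Type u} [CStarAlgebra X] [PartialOrder X] [StarOrderedRing X]
  {H : Type v} [NormedAddCommGroup H] [InnerProductSpace ℂ H] [CompleteSpace H]
  {M : VonNeumannAlgebra H} {S : Type w} [MeasurableSpace S]

/-- The normal functionals separate the points of a von Neumann algebra. -/
lemma eq_of_forall_normalFunctional {A B : M.toStarSubalgebra}
    (h : ∀ ρ : NormalFunctional M, ρ.toLinearMap A = ρ.toLinearMap B) : A = B := by
  refine Subtype.ext (ContinuousLinearMap.ext fun l => ext_inner_left ℂ fun k => ?_)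
  have := h (NormalFunctional.vector M k l)
  rwa [NormalFunctional.vector_apply, NormalFunctional.vector_apply] at this

namespace CPMeasure

variable (μ : CPMeasure S X M)

lemma scalar_apply (ρ : NormalFunctional M) (x : X) {Δ : Set S} (hΔ : MeasurableSet Δ) :
    μ.scalar ρ x Δ = ρ.toLinearMap ((μ.toFun Δ).val x) := if_pos hΔ

lemma apply_union {Δ Δ' : Set S} (hΔ : MeasurableSet Δ) (hΔ' : MeasurableSet Δ')
    (hd : Disjoint Δ Δ') (x : X) : (μ.toFun (Δ ∪ Δ')).toLinearMap x
      = (μ.toFun Δ).toLinearMap x + (μ.toFun Δ').toLinearMap x := by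
  have : (μ.toFun (Δ ∪ Δ')).val x = (μ.toFun Δ).val x + (μ.toFun Δ').val x := by
    refine eq_of_forall_normalFunctional fun ρ => ?_
    rw [map_add, ← scalar_apply μ ρ x hΔ, ← scalar_apply μ ρ x hΔ',
      ← scalar_apply μ ρ x (hΔ.union hΔ'), VectorMeasure.of_union hd hΔ hΔ']
  exact congrArg Subtype.val this

lemma barycenter_apply {Δ : Set S} (hΔ : MeasurableSet Δ) (x : X) :
    μ.barycenter.toLinearMap x
      = (μ.toFun Δ).toLinearMap x + (μ.toFun Δᶜ).toLinearMap x := by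
  rw [← μ.apply_union hΔ hΔ.compl disjoint_compl_right, Set.union_compl_self]
  rfl

lemma add_compl_eq_barycenter {Δ : Set S} (hΔ : MeasurableSet Δ) :
    μ.toFun Δ + μ.toFun Δᶜ = μ.barycenter :=
  CPMap.ext_apply fun x => (μ.barycenter_apply hΔ x).symm

variable {μ}

/-- The scalar measures are absolutely continuous with respect to a reference measure, because
`μ(Δ) = 0` as soon as `μ(Δ) 1 = 0`. -/
lemma IsReference.variation_absolutelyContinuous {ν : Measure S} (hν : μ.IsReference ν)
    (ρ : NormalFunctional M) (x : X) : (μ.scalar ρ x).variation ≪ ν := by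
  obtain ⟨-, ρ₀, -, hfaith, hnull⟩ := hν
  refine Measure.AbsolutelyContinuous.mk fun Δ hΔ h0 => ?_
  refine (VectorMeasure.variation_apply_eq_zero hΔ).2 fun t ht htm => ?_
  have h1 := hfaith _ (μ.toFun t).nonneg_apply_one
    ((hnull t htm).1 (measure_mono_null ht h0))
  have h2 : (μ.toFun t).val x = 0 :=
    Subtype.ext ((μ.toFun t).apply_eq_zero (congrArg Subtype.val h1) x)
  rw [scalar_apply μ ρ x htm, h2, map_zero]

/-- `κ_μ(f)` is unique. -/
lemma IsKappa.unique {ν : Measure S} {f : Lp ℂ ∞ ν}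
    {A B : μ.barycenter.K →L[ℂ] μ.barycenter.K} (hA : μ.IsKappa f A) (hB : μ.IsKappa f B) :
    A = B := by
  refine (stinespring _).ext_of_mem_centralizer
    (CPMap.relCommutant_subset_centralizer _ hA.1) (CPMap.relCommutant_subset_centralizer _ hB.1)
    fun x => ?_
  obtain ⟨hx, h1⟩ := hA.2 x
  obtain ⟨hy, h2⟩ := hB.2 x
  exact congrArg Subtype.val (eq_of_forall_normalFunctional (A := ⟨_, hx⟩) (B := ⟨_, hy⟩)
    fun ρ => (h1 ρ).trans (h2 ρ).symm)

lemma isKappa_indicator {ν : Measure S} (hν : μ.IsReference ν) {Δ : Set S}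
    (hΔ : MeasurableSet Δ) (hfin : ν Δ ≠ ∞) {P : μ.barycenter.K →L[ℂ] μ.barycenter.K}
    (hP : P ∈ μ.barycenter.relCommutant)
    (hPx : ∀ x, (μ.toFun Δ).toLinearMap x = μ.barycenter.compress P x) :
    μ.IsKappa (indicatorConstLp ∞ hΔ hfin (1 : ℂ)) P := by
  refine ⟨hP, fun x => ⟨hPx x ▸ (μ.toFun Δ).mem' x, fun ρ => ?_⟩⟩
  have h1 : (fun s => indicatorConstLp ∞ hΔ hfin (1 : ℂ) s)
      =ᵐ[(μ.scalar ρ x).variation] Δ.indicator fun _ => 1 :=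
    (hν.variation_absolutelyContinuous ρ x).ae_eq indicatorConstLp_coeFn
  rw [VectorMeasure.integral_congr_ae h1, integral_indicator_one _ hΔ, scalar_apply μ ρ x hΔ]
  exact congrArg ρ.toLinearMap (Subtype.ext (hPx x).symm)

/-- A subcentral measure has disjoint values on complementary sets: the projection that implements
the orthogonality of `μ(Δ)` and `μ(Δᶜ)` is `κ_μ(1_Δ)`, which is central. -/
theorem IsSubcentral.disjointCP (h : μ.IsSubcentral) {Δ : Set S} (hΔ : MeasurableSet Δ) :
    (μ.toFun Δ).DisjointCP (μ.toFun Δᶜ) := by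
  obtain ⟨horth, ν, hν, 𝔅, h𝔅, -, hsub⟩ := h
  obtain ⟨P, hP, hproj, hPx⟩ := (CPMap.orthogonal_iff (μ.add_compl_eq_barycenter hΔ)).1 (horth Δ hΔ)
  have := hν.1
  have hmem : P ∈ (𝔅 : Set (μ.barycenter.K →L[ℂ] μ.barycenter.K)) := by
    rw [h𝔅]
    exact ⟨_, isKappa_indicator hν hΔ (measure_ne_top ν Δ) hP fun x => (hPx x).1⟩
  have hP'' := (hsub hmem).1
  rw [coe_bicommutant] at hP''
  exact disjointReps_of_central_projection (stinespring μ.barycenter.toCompletelyPositiveMap)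
    (stinespring _) (stinespring _) (fun x => μ.barycenter_apply hΔ x) hproj
    (CPMap.relCommutant_subset_centralizer _ hP) hP'' fun x => (hPx x).1

end CPMeasure

end CPMeasures

/-! ### The central projection valued measure of a measure with disjoint values -/

section CentralDecomposition

variable {X : Type u} [CStarAlgebra X] [PartialOrder X] [StarOrderedRing X]
  {H : Type v} [NormedAddCommGroup H] [InnerProductSpace ℂ H] [CompleteSpace H]
  {M : VonNeumannAlgebra H} {S : Type w} [MeasurableSpace S]

namespace CPMeasure

variable {μ : CPMeasure S X M}

/-- `P` implements `μ` by projections in the centre of `π_T(X)''`, where `T` is the barycenter. -/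
structure IsCentralDecomposition (μ : CPMeasure S X M)
    (P : Set S → μ.barycenter.K →L[ℂ] μ.barycenter.K) : Prop where
  proj : ∀ Δ, MeasurableSet Δ → IsStarProjection (P Δ)
  mem_commutant : ∀ Δ, MeasurableSet Δ → P Δ ∈ Set.centralizer (Set.range μ.barycenter.π)
  mem_bicommutant : ∀ Δ, MeasurableSet Δ →
    P Δ ∈ Set.centralizer (Set.centralizer (Set.range μ.barycenter.π))
  apply_eq : ∀ Δ, MeasurableSet Δ → ∀ x,
    (μ.toFun Δ).toLinearMap x = μ.barycenter.compress (P Δ) x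

/-- A measure whose values on complementary sets are disjoint is implemented by central
projections. -/
theorem exists_isCentralDecomposition
    (h : ∀ Δ : Set S, MeasurableSet Δ → (μ.toFun Δ).DisjointCP (μ.toFun Δᶜ)) :
    ∃ P, μ.IsCentralDecomposition P := by
  have key : ∀ Δ : Set S, ∃ P : μ.barycenter.K →L[ℂ] μ.barycenter.K, MeasurableSet Δ →
      IsStarProjection P ∧ P ∈ Set.centralizer (Set.range μ.barycenter.π) ∧
      P ∈ Set.centralizer (Set.centralizer (Set.range μ.barycenter.π)) ∧
      ∀ x, (μ.toFun Δ).toLinearMap x = μ.barycenter.compress P x := by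
    intro Δ
    by_cases hΔ : MeasurableSet Δ
    · obtain ⟨P, hP⟩ := exists_central_projection
        (stinespring μ.barycenter.toCompletelyPositiveMap) (stinespring _) (stinespring _)
        (fun x => μ.barycenter_apply hΔ x) (h Δ hΔ)
      exact ⟨P, fun _ => hP⟩
    · exact ⟨0, fun h => absurd h hΔ⟩
  choose P hP using key
  exact ⟨P, fun Δ hΔ => (hP Δ hΔ).1, fun Δ hΔ => (hP Δ hΔ).2.1, fun Δ hΔ => (hP Δ hΔ).2.2.1,
    fun Δ hΔ => (hP Δ hΔ).2.2.2⟩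

namespace IsCentralDecomposition

variable {P : Set S → μ.barycenter.K →L[ℂ] μ.barycenter.K}

/-- An operator in `π_T(X)'` is determined by its compression. -/
lemma eq_of_compress {A B : μ.barycenter.K →L[ℂ] μ.barycenter.K}
    (hA : A ∈ Set.centralizer (Set.range μ.barycenter.π))
    (hB : B ∈ Set.centralizer (Set.range μ.barycenter.π))
    (h : ∀ x, μ.barycenter.compress A x = μ.barycenter.compress B x) : A = B :=
  (stinespring _).ext_of_mem_centralizer hA hB h

/-- The implementing projections are unique, and hence additive in `Δ`; being commuting projections
with additive values they are multiplicative. -/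
theorem isProjectionMeasure (hP : μ.IsCentralDecomposition P) : IsProjectionMeasure P := by
  have hunion : ∀ Δ Δ', MeasurableSet Δ → MeasurableSet Δ' → Disjoint Δ Δ' →
      P (Δ ∪ Δ') = P Δ + P Δ' := by
    intro Δ Δ' hΔ hΔ' hd
    refine eq_of_compress (hP.mem_commutant _ (hΔ.union hΔ'))
      (Set.add_mem_centralizer (hP.mem_commutant _ hΔ) (hP.mem_commutant _ hΔ')) fun x => ?_
    rw [← hP.apply_eq _ (hΔ.union hΔ'), μ.apply_union hΔ hΔ' hd, hP.apply_eq _ hΔ,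
      hP.apply_eq _ hΔ']
    ext k
    simp [CPMap.compress]
  have hcomm : ∀ Δ Δ', MeasurableSet Δ → MeasurableSet Δ' → P Δ * P Δ' = P Δ' * P Δ :=
    fun Δ Δ' hΔ hΔ' => hP.mem_bicommutant Δ' hΔ' _ (hP.mem_commutant Δ hΔ)
  -- Commuting projections whose sum is a projection are orthogonal.
  have hdisj : ∀ Δ Δ', MeasurableSet Δ → MeasurableSet Δ' → Disjoint Δ Δ' →
      P Δ * P Δ' = 0 := by
    intro Δ Δ' hΔ hΔ' hd
    have h1 := (hP.proj _ (hΔ.union hΔ')).isIdempotentElem.eq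
    have h2 := (hP.proj _ hΔ).isIdempotentElem.eq
    have h3 := (hP.proj _ hΔ').isIdempotentElem.eq
    rw [hunion Δ Δ' hΔ hΔ' hd, add_mul, mul_add, mul_add, h2, h3, ← hcomm Δ Δ' hΔ hΔ'] at h1
    have h4 : (2 : ℂ) • (P Δ * P Δ') = 0 := by
      rw [two_smul]
      have h5 : P Δ * P Δ' + P Δ * P Δ'
          = (P Δ + P Δ * P Δ' + (P Δ * P Δ' + P Δ')) - (P Δ + P Δ') := by abel
      rw [h5, h1, sub_self]
    exact (smul_eq_zero.1 h4).resolve_left two_ne_zero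
  refine ⟨hP.proj, ?_, ?_, hunion⟩
  · refine eq_of_compress (hP.mem_commutant _ MeasurableSet.univ) Set.one_mem_centralizer
      fun x => ?_
    rw [← hP.apply_eq _ MeasurableSet.univ]
    exact μ.barycenter.apply_eq_compress x
  · intro Δ Δ' hΔ hΔ'
    have h1 := hunion (Δ ∩ Δ') (Δ \ Δ') (hΔ.inter hΔ') (hΔ.diff hΔ')
      Set.disjoint_sdiff_inter.symm
    have h2 := hunion (Δ ∩ Δ') (Δ' \ Δ) (hΔ.inter hΔ') (hΔ'.diff hΔ)
      (Set.disjoint_sdiff_right.mono_left Set.inter_subset_left)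
    rw [Set.inter_union_sdiff] at h1
    rw [Set.inter_comm, Set.inter_union_sdiff, Set.inter_comm] at h2
    rw [h1, h2, add_mul, mul_add, mul_add,
      (hP.proj _ (hΔ.inter hΔ')).isIdempotentElem.eq,
      hdisj _ _ (hΔ.inter hΔ') (hΔ'.diff hΔ)
        (Set.disjoint_sdiff_right.mono_left Set.inter_subset_left),
      hdisj _ _ (hΔ.diff hΔ') (hΔ.inter hΔ') Set.disjoint_sdiff_inter,
      hdisj _ _ (hΔ.diff hΔ') (hΔ'.diff hΔ)
        (Set.disjoint_sdiff_right.mono_left Set.sdiff_subset)]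
    simp

lemma algebra_subset_commutant (hP : μ.IsCentralDecomposition P)
    {A : μ.barycenter.K →L[ℂ] μ.barycenter.K} (hA : A ∈ hP.isProjectionMeasure.algebra) :
    A ∈ Set.centralizer (Set.range μ.barycenter.π) := by
  refine Set.centralizer_subset ?_ (hP.isProjectionMeasure.mem_algebra_iff.1 hA)
  rintro _ ⟨x, rfl⟩ _ ⟨Δ, hΔ, rfl⟩
  exact (hP.mem_commutant Δ hΔ _ ⟨x, rfl⟩).symm

lemma algebra_subset_bicommutant (hP : μ.IsCentralDecomposition P)
    {A : μ.barycenter.K →L[ℂ] μ.barycenter.K} (hA : A ∈ hP.isProjectionMeasure.algebra) :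
    A ∈ bicommutant μ.barycenter.π := by
  rw [← SetLike.mem_coe, coe_bicommutant]
  refine Set.centralizer_subset ?_ (hP.isProjectionMeasure.mem_algebra_iff.1 hA)
  rintro B hB _ ⟨Δ, hΔ, rfl⟩
  exact (hP.mem_bicommutant Δ hΔ B hB).symm

/-- For `A ∈ P(S)''` the map `x ↦ V* A π(x) V` has values in `M`: this holds for `A = P(Δ)`, and
commuting with an element of `M'` is a σ-weakly closed condition. -/
lemma compress_mem (hP : μ.IsCentralDecomposition P)
    {A : μ.barycenter.K →L[ℂ] μ.barycenter.K} (hA : A ∈ hP.isProjectionMeasure.algebra) (x : X) :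
    μ.barycenter.compress A x ∈ M.toStarSubalgebra := by
  suffices h : μ.barycenter.compress A x ∈ M.commutant.commutant by
    rwa [M.commutant_commutant] at h
  rw [VonNeumannAlgebra.mem_commutant_iff]
  intro C hC
  ext l
  refine ext_inner_left ℂ fun k => ?_
  -- The two vectors and their partners encode `⟨k, [C, V* B π(x) V] l⟩` as a normal functional
  -- of `B`.
  let V := μ.barycenter.V
  let a : Bool → μ.barycenter.K := fun b => cond b (V (adjoint C k)) (-V k)
  let b : Bool → μ.barycenter.K :=
    fun b => cond b (μ.barycenter.π x (V l)) (μ.barycenter.π x (V (C l)))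
  have key : ∀ B : μ.barycenter.K →L[ℂ] μ.barycenter.K, ∑' i, ⟪a i, B (b i)⟫_ℂ
      = ⟪k, (C * μ.barycenter.compress B x) l⟫_ℂ - ⟪k, (μ.barycenter.compress B x * C) l⟫_ℂ := by
    intro B
    rw [tsum_fintype, Fintype.sum_bool]
    change ⟪V (adjoint C k), B (μ.barycenter.π x (V l))⟫_ℂ
      + ⟪-V k, B (μ.barycenter.π x (V (C l)))⟫_ℂ
      = ⟪k, C (adjoint V (B (μ.barycenter.π x (V l))))⟫_ℂ
        - ⟪k, adjoint V (B (μ.barycenter.π x (V (C l))))⟫_ℂ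
    rw [inner_neg_left, adjoint_inner_right, ← adjoint_inner_left C, adjoint_inner_right,
      sub_eq_add_neg]
  rw [← sub_eq_zero, ← key]
  refine hP.isProjectionMeasure.tsum_inner_eq_zero (Summable.of_finite) (Summable.of_finite)
    (fun Δ hΔ => ?_) hA
  rw [key, ← hP.apply_eq Δ hΔ, sub_eq_zero,
    VonNeumannAlgebra.mem_commutant_iff.1 hC _ ((μ.toFun Δ).mem' x)]

/-- Separating vectors for `M` yield separating vectors for `P(S)''`: if `D` annihilates the vectors
`V x n`, then `V* D* D V ∈ M` annihilates the vectors `x n`. -/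
lemma separating (hP : μ.IsCentralDecomposition P) {x : ℕ → H}
    (hsep : ∀ A ∈ M, (∀ n, A (x n) = 0) → A = 0) {D : μ.barycenter.K →L[ℂ] μ.barycenter.K}
    (hD : D ∈ hP.isProjectionMeasure.algebra) (h : ∀ n, D (μ.barycenter.V (x n)) = 0) : D = 0 := by
  have hmem : adjoint D * D ∈ hP.isProjectionMeasure.algebra :=
    mul_mem (star_mem (S := VonNeumannAlgebra μ.barycenter.K) hD) hD
  have h0 := hsep _ (hP.compress_mem hmem 1) fun n => by
    change adjoint μ.barycenter.V (adjoint D (D (μ.barycenter.π 1 (μ.barycenter.V (x n))))) = 0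
    rw [map_one]
    change adjoint μ.barycenter.V (adjoint D (D (μ.barycenter.V (x n)))) = 0
    rw [h, map_zero, map_zero]
  have hDV : ∀ k, D (μ.barycenter.V k) = 0 := by
    intro k
    refine inner_self_eq_zero (𝕜 := ℂ).1 ?_
    rw [← adjoint_inner_right, ← adjoint_inner_right]
    have h1 : μ.barycenter.compress (adjoint D * D) 1 k = 0 := by rw [h0]; rfl
    have h2 : adjoint μ.barycenter.V (adjoint D (D (μ.barycenter.V k))) = 0 := by
      have h3 : μ.barycenter.compress (adjoint D * D) 1 k
        = adjoint μ.barycenter.V (adjoint D (D (μ.barycenter.π 1 (μ.barycenter.V k)))) := rfl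
      rw [h1, map_one] at h3
      exact h3.symm
    rw [h2, inner_zero_right]
  refine (stinespring μ.barycenter.toCompletelyPositiveMap).operator_ext fun y k => ?_
  have h4 : D (μ.barycenter.π y (μ.barycenter.V k)) = μ.barycenter.π y (D (μ.barycenter.V k)) :=
    (DFunLike.congr_fun (hP.algebra_subset_commutant hD _ ⟨y, rfl⟩) (μ.barycenter.V k)).symm
  rw [hDV, map_zero] at h4
  exact h4

lemma mem_relCommutant (hP : μ.IsCentralDecomposition P)
    {A : μ.barycenter.K →L[ℂ] μ.barycenter.K}
    (hA : A ∈ (Submodule.span ℂ (P '' {Δ | MeasurableSet Δ})).topologicalClosure) :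
    A ∈ μ.barycenter.relCommutant := by
  refine CPMap.span_closure_subset_relCommutant _ ?_ hA
  rintro _ ⟨Δ, hΔ, rfl⟩
  exact ⟨hP.mem_commutant Δ hΔ, (hP.proj Δ hΔ).nonneg, (hP.proj Δ hΔ).le_one, μ.toFun Δ,
    hP.apply_eq Δ hΔ⟩

theorem isOrthogonal (hP : μ.IsCentralDecomposition P) : μ.IsOrthogonal := by
  intro Δ hΔ
  refine (CPMap.orthogonal_iff (μ.add_compl_eq_barycenter hΔ)).2 ⟨P Δ, ?_, hP.proj Δ hΔ,
    fun x => ⟨hP.apply_eq Δ hΔ x, ?_⟩⟩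
  · exact hP.mem_relCommutant (represents_indicator hΔ).1
  · have h1 := hP.isProjectionMeasure.union Δ Δᶜ hΔ hΔ.compl disjoint_compl_right
    rw [Set.union_compl_self, hP.isProjectionMeasure.univ] at h1
    rw [h1, add_sub_cancel_left, hP.apply_eq _ hΔ.compl]

/-- An operator that represents a bounded function `f` is `κ_μ(f)`. -/
lemma isKappa (hP : μ.IsCentralDecomposition P) {ν : Measure S} (hν : μ.IsReference ν)
    {f : S → ℂ} {A : μ.barycenter.K →L[ℂ] μ.barycenter.K} (hA : Represents P f A) {g : Lp ℂ ∞ ν}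
    (hg : g =ᵐ[ν] f) : μ.IsKappa g A := by
  have hmem := hP.isProjectionMeasure.mem_algebra_of_represents hA
  refine ⟨hP.mem_relCommutant hA.1, fun x => ⟨hP.compress_mem hmem x, fun ρ => ?_⟩⟩
  rw [VectorMeasure.integral_congr_ae ((hν.variation_absolutelyContinuous ρ x).ae_eq hg)]
  obtain ⟨σ, hσ⟩ := ρ.exists_trace
  -- `τ` is the functional `B ↦ ρ(V* B π(x) V)` on `B(K)`.
  let τ : TracePair μ.barycenter.K := ⟨fun n => μ.barycenter.V (σ.x n),
    fun n => μ.barycenter.π x (μ.barycenter.V (σ.y n)), summable_norm_sq_map _ σ.summable_x,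
    summable_norm_sq_map _ (summable_norm_sq_map _ σ.summable_y)⟩
  have hτ : ∀ B, τ.traceCLM B = σ.trace (μ.barycenter.compress B x) := fun B =>
    tsum_congr fun n => (adjoint_inner_right _ _ _).symm
  rw [hσ, ← hτ]
  refine (hA.2 τ.traceCLM _ (isBoundedIntegral_integral (μ.scalar ρ x)) fun Δ hΔ => ?_).symm
  rw [integral_indicator_one _ hΔ, scalar_apply μ ρ x hΔ, hτ, hσ, ← hP.apply_eq Δ hΔ]
  rfl

/-- The functional `μ(Δ) 1 ↦ ∑ ⟨x n, μ(Δ) 1 x n⟩` in terms of the projections. -/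
lemma diagonal_apply (hP : μ.IsCentralDecomposition P) {x : ℕ → H}
    (hx : Summable fun n => ‖x n‖ ^ 2) {Δ : Set S} (hΔ : MeasurableSet Δ) :
    (NormalFunctional.ofTracePair M (TracePair.diagonal x hx)).toLinearMap ((μ.toFun Δ).val 1)
      = ((∑' n, ‖P Δ (μ.barycenter.V (x n))‖ ^ 2 : ℝ) : ℂ) := by
  rw [NormalFunctional.ofTracePair_apply, Complex.ofReal_tsum]
  refine tsum_congr fun n => ?_
  change ⟪x n, (μ.toFun Δ).toLinearMap 1 (x n)⟫_ℂ = _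
  rw [← hP.isProjectionMeasure.inner_apply hΔ, hP.apply_eq Δ hΔ, CPMap.compress, map_one,
    comp_apply, comp_apply, comp_apply, one_apply_eq_self, adjoint_inner_right]

/-- A separating sequence in `H` induces a finite measure `Δ ↦ ρ(μ(Δ) 1)`. -/
lemma exists_measure (hP : μ.IsCentralDecomposition P) {x : ℕ → H}
    (hx : Summable fun n => ‖x n‖ ^ 2) :
    ∃ ν : Measure S, IsFiniteMeasure ν ∧ ∀ Δ, MeasurableSet Δ →
      ν.real Δ = ∑' n, ‖P Δ (μ.barycenter.V (x n))‖ ^ 2 := by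
  let m : SignedMeasure S := ComplexMeasure.re
    (μ.scalar (NormalFunctional.ofTracePair M (TracePair.diagonal x hx)) 1)
  have hm : ∀ Δ, MeasurableSet Δ → m Δ = ∑' n, ‖P Δ (μ.barycenter.V (x n))‖ ^ 2 := by
    intro Δ hΔ
    change (μ.scalar _ 1 Δ).re = _
    rw [scalar_apply μ _ 1 hΔ, hP.diagonal_apply hx hΔ, Complex.ofReal_re]
  have hpos : VectorMeasure.restrict 0 Set.univ ≤ m.restrict Set.univ :=
    VectorMeasure.restrict_le_restrict_of_subset_le _ _ fun Δ hΔ _ => by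
      rw [hm Δ hΔ]
      exact tsum_nonneg fun n => sq_nonneg _
  refine ⟨m.toMeasureOfZeroLE Set.univ MeasurableSet.univ hpos, inferInstance, fun Δ hΔ => ?_⟩
  rw [SignedMeasure.toMeasureOfZeroLE_real_apply _ hpos MeasurableSet.univ hΔ, Set.univ_inter,
    hm Δ hΔ]

/-- A measure that is implemented by central projections is subcentral, because the operators
`κ_μ(f)` are exactly the elements of the von Neumann algebra `P(S)''`. -/
theorem isSubcentral [Nontrivial H] (hM : IsSigmaFinite M) (hP : μ.IsCentralDecomposition P) :
    μ.IsSubcentral := by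
  obtain ⟨x, hx, hsep⟩ := hM.exists_square_summable_separating
  obtain ⟨ν, hfin, hν⟩ := hP.exists_measure hx.summable
  have href : μ.IsReference ν := by
    refine ⟨hfin, _, NormalFunctional.isState_diagonal hx,
      NormalFunctional.isFaithful_diagonal hx.summable hsep, fun Δ hΔ => ?_⟩
    rw [hP.diagonal_apply hx.summable hΔ, ← hν Δ hΔ, Complex.ofReal_eq_zero, measureReal_eq_zero_iff]
  have hrange : (hP.isProjectionMeasure.algebra : Set (μ.barycenter.K →L[ℂ] μ.barycenter.K))
      = μ.kappaRange ν := by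
    refine Set.Subset.antisymm (fun A hA => ?_) ?_
    · obtain ⟨f, hf, hfA⟩ := hP.isProjectionMeasure.exists_represents_of_mem_algebra
        (summable_norm_sq_map μ.barycenter.V hx.summable) hν
        (fun D hD => hP.separating hsep hD) hA
      obtain ⟨c, hc⟩ := hf.2
      have hfL : MemLp f ∞ ν :=
        memLp_top_of_bound hf.1.aestronglyMeasurable c (Filter.Eventually.of_forall hc)
      exact ⟨hfL.toLp f, hP.isKappa href hfA hfL.coeFn_toLp⟩
    · rintro A ⟨g, hg⟩
      -- Replace `g` by a representative that is bounded everywhere.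
      let c : ℝ≥0∞ := eLpNormEssSup g ν
      have hc : c ≠ ∞ := by
        have := (Lp.memLp g).2.ne
        rwa [eLpNorm_exponent_top] at this
      let G : Set S := {s | ‖g s‖ₑ ≤ c}
      have hgm : Measurable g := (Lp.stronglyMeasurable g).measurable
      have hG : MeasurableSet G := measurableSet_le hgm.enorm measurable_const
      have hb : IsBddMeasurable (G.indicator g) := by
        refine ⟨hgm.indicator hG, c.toReal, fun s => ?_⟩
        by_cases hs : s ∈ G
        · rw [Set.indicator_of_mem hs, ← toReal_enorm]
          exact ENNReal.toReal_mono hc hs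
        · simp [Set.indicator_of_notMem hs]
      obtain ⟨B, hB⟩ := exists_represents hP.isProjectionMeasure.norm_le hb
      have hgG : g =ᵐ[ν] G.indicator g := by
        filter_upwards [ae_le_eLpNormEssSup (f := g) (μ := ν)] with s hs
        rw [Set.indicator_of_mem (show s ∈ G from hs)]
      rw [hg.unique (hP.isKappa href hB hgG)]
      exact hP.isProjectionMeasure.mem_algebra_of_represents hB
  refine ⟨hP.isOrthogonal, ν, href, hP.isProjectionMeasure.algebra, hrange,
    fun A hA B hB => hP.isProjectionMeasure.algebra_comm hA hB, fun A hA =>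
      ⟨hP.algebra_subset_bicommutant hA, ?_⟩⟩
  rw [hrange] at hA
  exact hA.choose_spec.1

end IsCentralDecomposition

end CPMeasure

end CentralDecomposition

end CPMeasureTheory

theorem mainTheorem4 {X : Type u} [CStarAlgebra X] [PartialOrder X] [StarOrderedRing X]
    {H : Type v} [NormedAddCommGroup H] [InnerProductSpace ℂ H] [CompleteSpace H] [Nontrivial H]
    (M : VonNeumannAlgebra H) (hM : CPMeasureTheory.IsSigmaFinite M)
    {S : Type w} [MeasurableSpace S] (μ : CPMeasureTheory.CPMeasure S X M) :
    (∀ Δ : Set S, MeasurableSet Δ → (μ.toFun Δ).DisjointCP (μ.toFun Δᶜ)) ↔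
      μ.IsSubcentral := by
  refine ⟨fun h => ?_, fun h Δ hΔ => h.disjointCP hΔ⟩
  obtain ⟨P, hP⟩ := CPMeasureTheory.CPMeasure.exists_isCentralDecomposition h
  exact hP.isSubcentral hM
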